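/- The discrete Toda equation is the system \[ I_n^{t+1}=J_n^t+U_n^t,\qquad J_n^{t+1}=\frac{I_{n+1}^tJ_n^t}{I_n^{t+1}},\qquad U_{n+1}^t=\frac{I_{n+1}^tU_n^t}{I_n^{t+1}},\qquad n,t\in\mathbb{Z}, \] for variables $(I_n^t,J_n^t,U_n^t)_{n,t\in\mathbb{Z}}$ with values in $(0,\infty)$. For those $(I^0,J^0)=(I^0_n,J^0_n)_{n\in\mathbb{Z}}$ for which there is exactly one solution $(I_n^t,J_n^t,U_n^t)_{n,t\in\mathbb{Z}}$ with the given values at $t=0$, put $\mathcal{T}_{dT}(I^0,J^0):=(I^1,J^1)=(I^1_n,J^1_n)_{n\in\mathbb{Z}}$. For $\lambda,c>0$ let $\mathrm{Gam}(\lambda,c)$ be the probability distribution with density proportional to $x^{\lambda-1}e^{-cx}\mathbf{1}_{(0,\infty)}(x)$. We say that the law of a random configuration $(I^0,J^0)$ is invariant under $\mathcal{T}_{dT}$ if, almost surely, $\mathcal{T}_{dT}(I^0,J^0)$ is defined, and $\mathcal{T}_{dT}(I^0,J^0)$ has the same distribution as $(I^0,J^0)$. **Theorem.** Let $(I^0_n,J^0_n)_{n\in\mathbb{Z}}$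 be an i.i.d. sequence of pairs of random variables, with $I^0_n$ independent of $J^0_n$ for each $n$. (1) If, for some $\lambda_1,\lambda_2,c>0$, $I^0_n\sim\mathrm{Gam}(\lambda_1+\lambda_2,c)$ and $J^0_n\sim\mathrm{Gam}(\lambda_1,c)$, i.e. the marginal is $\mathrm{Gam}(\lambda_1+\lambda_2,c)\times\mathrm{Gam}(\lambda_1,c)$, then the law of $(I^0,J^0)$ is invariant under $\mathcal{T}_{dT}$. (2) Conversely, if the law of $(I^0,J^0)$ is invariant under $\mathcal{T}_{dT}$ and is non-trivial, meaning that $I^0_0$ and $J^0_0$ are not both almost surely constant, then there are $\lambda_1,\lambda_2,c>0$ such that the marginal is $\mathrm{Gam}(\lambda_1+\lambda_2,c)\times\mathrm{Gam}(\lambda_1,c)$. -/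

import Mathlib

open MeasureTheory ProbabilityTheory

/-- A collection `(I_n^t, J_n^t, U_n^t)`, `n, t ∈ ℤ`, of real lattice variables. The first argument
of each field is the time `t`, the second one is the space coordinate `n`. -/
@[ext]
structure TodaField where
  I : ℤ → ℤ → ℝ
  J : ℤ → ℤ → ℝ
  U : ℤ → ℤ → ℝ

/-- `w` is a solution of the discrete Toda equation on the whole lattice `ℤ × ℤ`; the lattice
variables take values in `(0, ∞)`. -/
structure TodaField.IsSolution (w : TodaField) : Prop where
  I_pos : ∀ t n, 0 < w.I t n
  J_pos : ∀ t n, 0 < w.J t n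
  U_pos : ∀ t n, 0 < w.U t n
  I_eq : ∀ t n, w.I (t + 1) n = w.J t n + w.U t n
  J_eq : ∀ t n, w.J (t + 1) n = w.I t (n + 1) * w.J t n * (w.I (t + 1) n)⁻¹
  U_eq : ∀ t n, w.U t (n + 1) = w.I t (n + 1) * w.U t n * (w.I (t + 1) n)⁻¹

/-- The configuration `(I_n^t, J_n^t)`, `n ∈ ℤ`, at time `t`. -/
def TodaField.config (w : TodaField) (t : ℤ) : ℤ → ℝ × ℝ :=
  fun n => (w.I t n, w.J t n)

/-- `w` solves the initial value problem with initial configuration `x` at time `0`. -/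
def TodaField.SolvesIVP (w : TodaField) (x : ℤ → ℝ × ℝ) : Prop :=
  w.IsSolution ∧ w.config 0 = x

/-- The set of initial configurations for which the initial value problem has exactly one
solution. All its elements have strictly positive entries. -/
def todaDomain : Set (ℤ → ℝ × ℝ) :=
  {x | ∃! w : TodaField, w.SolvesIVP x}

open scoped Classical in
/-- The one time-step dynamics `(I^0, J^0) ↦ (I^1, J^1)`, where `(I^t, J^t, U^t)` is the unique
solution of the initial value problem. Outside `todaDomain` the value is irrelevant. -/
noncomputable def todaStep (x : ℤ → ℝ × ℝ) : ℤ → ℝ × ℝ :=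
  if h : x ∈ todaDomain then (Exists.choose h).config 1 else 0

/-- The law of the random configuration `X` is invariant under the dynamics: almost surely the
dynamics are defined at `X`, and `todaStep X` has the same distribution as `X`. -/
structure IsTodaInvariant {Ω : Type*} [MeasurableSpace Ω] (P : Measure Ω)
    (X : Ω → ℤ → ℝ × ℝ) : Prop where
  mem_domain : ∀ᵐ ω ∂P, X ω ∈ todaDomain
  identDistrib : IdentDistrib (fun ω => todaStep (X ω)) X P P

namespace Toda

open scoped ENNReal
open Filter Topology

/-! The equation is nonlinear in the carrier `U` but linear in V = 1/U: V_{n+1} = 1/I_{n+1} +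
(J_n/I_{n+1}) V_n. The minimal nonnegative solution `vmin` is an explicit series in the variables to
the left, and any other positive solution exceeds it by a solution of the homogeneous recursion.
`U_eq_umin` rules out such an excess: it would make U/J summable to the left and then, through
`term_config_succ`, make the terms of the series at the next time unbounded, so that no carrier
could exist there. Hence, as soon as the products of J/I become arbitrarily small, the carrier is
`umin` and the step is `evolve`. For i.i.d. data this smallness follows from finiteness of `vmin`.
Since the local map is an involution, reversing time and space turns solutions into solutions, so
the backward dynamics are the forward dynamics of the reflected configuration.

For (1), the sum of two independent gamma variables with a common rate is independent of their
ratio. This makes the local map preserve Gam(a+b) × Gam(a) × Gam(b) (`localMap_gamma`). A Burke-type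
induction (`burke`) then shows that a stationary carrier leaves behind independent outputs with the
original law. The same induction, applied to a carrier started far to the left, gives finiteness of
`vmin` and the law of `umin`.

For (2), J_0 and U_0 are independent because U_0 depends only on inputs to the left. At time 1, the
reversed dynamics express U_1 through sites strictly to the right of 0, so by invariance I'_0, J'_0
and U_1 are independent as well. Now I'_0 = J_0 + U_0, while J_0/(J_0+U_0) = J'_0/(J'_0+U_1). Thus
the sum and the ratio of J_0 and U_0 are independent, and Lukacs' theorem (`lukacs`) leaves only
point masses or gamma laws. -/

/-- The product of the `k` ratios `J_{m-1} / I_m` for `n - k < m ≤ n`. -/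
noncomputable def ratioProd (x : ℤ → ℝ × ℝ) : ℤ → ℕ → ℝ
  | _, 0 => 1
  | n, k + 1 => (x (n - 1)).2 / (x n).1 * ratioProd x (n - 1) k

/-- The summands of the minimal solution of the linear recursion satisfied by `1 / U`. -/
noncomputable def term (x : ℤ → ℝ × ℝ) (n : ℤ) (k : ℕ) : ℝ :=
  ratioProd x n k / (x (n - k)).1

/-- The minimal nonnegative solution of the linear recursion satisfied by `1 / U`. -/
noncomputable def vmin (x : ℤ → ℝ × ℝ) (n : ℤ) : ℝ≥0∞ :=
  ∑' k, ENNReal.ofReal (term x n k)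

/-- The carrier `U` that corresponds to the minimal solution `vmin` of the recursion of `1 / U`. -/
noncomputable def umin (x : ℤ → ℝ × ℝ) (n : ℤ) : ℝ := (vmin x n).toReal⁻¹

/-- One step of the evolution with carrier `umin`. -/
noncomputable def evolve (x : ℤ → ℝ × ℝ) : ℤ → ℝ × ℝ := fun n =>
  ((x n).2 + umin x n, (x (n + 1)).1 * (x n).2 * ((x n).2 + umin x n)⁻¹)

/-- The spatial reflection that conjugates the evolution to its inverse. -/
def reflect (x : ℤ → ℝ × ℝ) : ℤ → ℝ × ℝ := fun n => ((x (-n)).1, (x (-n - 1)).2)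

/-- All entries of the configuration are positive. -/
def Pos (x : ℤ → ℝ × ℝ) : Prop := ∀ n, 0 < (x n).1 ∧ 0 < (x n).2

/-- `V` satisfies the linear recursion of `1 / U`. -/
def LinRec (x : ℤ → ℝ × ℝ) (V : ℤ → ℝ) : Prop :=
  ∀ n, V (n + 1) = (x (n + 1)).1⁻¹ + (x n).2 / (x (n + 1)).1 * V n

/-- Configurations for which the carrier exists and decays to the left along a subsequence. -/
structure Regular (x : ℤ → ℝ × ℝ) : Prop where
  pos : Pos x
  vmin_ne_top : ∀ n, vmin x n ≠ ∞
  ratioProd_small : ∀ ε > 0, ∃ k, ratioProd x 0 k < ε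

/-! ### The linear recursion for the reciprocal carrier and its minimal solution -/

lemma reflect_reflect (x : ℤ → ℝ × ℝ) : reflect (reflect x) = x := by
  funext n; simp [reflect]

lemma ratioProd_pos {x : ℤ → ℝ × ℝ} (hx : Pos x) (n : ℤ) (k : ℕ) : 0 < ratioProd x n k := by
  induction k generalizing n with
  | zero => simp [ratioProd]
  | succ k ih => exact mul_pos (div_pos (hx _).2 (hx _).1) (ih _)

/-- The definition splits off the factor at `n`; unrolling a recursion leftwards needs the factor at
the far end. -/
lemma ratioProd_succ' (x : ℤ → ℝ × ℝ) (n : ℤ) (k : ℕ) :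
    ratioProd x n (k + 1) = ratioProd x n k * ((x (n - k - 1)).2 / (x (n - k)).1) := by
  induction k generalizing n with
  | zero => simp [ratioProd]
  | succ k ih =>
    rw [ratioProd, ih, ratioProd, mul_assoc]
    push_cast
    ring_nf

lemma term_pos {x : ℤ → ℝ × ℝ} (hx : Pos x) (n : ℤ) (k : ℕ) : 0 < term x n k :=
  div_pos (ratioProd_pos hx _ _) (hx _).1

lemma term_zero (x : ℤ → ℝ × ℝ) (n : ℤ) : term x n 0 = (x n).1⁻¹ := by
  simp [term, ratioProd]

lemma term_succ (x : ℤ → ℝ × ℝ) (n : ℤ) (k : ℕ) :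
    term x n (k + 1) = (x (n - 1)).2 / (x n).1 * term x (n - 1) k := by
  rw [term, term, ratioProd, mul_div_assoc]
  push_cast
  ring_nf

lemma LinRec.eq_sum {x : ℤ → ℝ × ℝ} {V : ℤ → ℝ} (hV : LinRec x V) (n : ℤ) (k : ℕ) :
    V n = ∑ i ∈ Finset.range k, term x n i + ratioProd x n k * V (n - k) := by
  induction k with
  | zero => simp [ratioProd]
  | succ k ih =>
    have h := hV (n - k - 1)
    rw [sub_add_cancel] at h
    rw [ih, h, Finset.sum_range_succ, ratioProd_succ', term]
    push_cast
    rw [← sub_sub]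
    ring

/-- Working in `ℝ≥0∞` keeps the recursion valid before finiteness is known. -/
lemma vmin_succ {x : ℤ → ℝ × ℝ} (hx : Pos x) (n : ℤ) :
    vmin x (n + 1) = ENNReal.ofReal (x (n + 1)).1⁻¹ +
      ENNReal.ofReal ((x n).2 / (x (n + 1)).1) * vmin x n := by
  rw [vmin, tsum_eq_zero_add' ENNReal.summable, term_zero, vmin, ← ENNReal.tsum_mul_left]
  congr 2
  funext k
  rw [term_succ, add_sub_cancel_right, ENNReal.ofReal_mul (div_pos (hx _).2 (hx _).1).le]

lemma sum_term_le_vmin {x : ℤ → ℝ × ℝ} (hx : Pos x) (n : ℤ) (hn : vmin x n ≠ ∞) (k : ℕ) :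
    ∑ i ∈ Finset.range k, term x n i ≤ (vmin x n).toReal := by
  rw [← ENNReal.ofReal_le_iff_le_toReal hn,
    ENNReal.ofReal_sum_of_nonneg fun i _ => (term_pos hx n i).le]
  exact ENNReal.sum_le_tsum _

lemma vmin_le {x : ℤ → ℝ × ℝ} (hx : Pos x) (n : ℤ) {c : ℝ}
    (h : ∀ k, ∑ i ∈ Finset.range k, term x n i ≤ c) : vmin x n ≤ ENNReal.ofReal c := by
  rw [vmin, ENNReal.tsum_eq_iSup_nat]
  refine iSup_le fun k => ?_
  rw [← ENNReal.ofReal_sum_of_nonneg fun i _ => (term_pos hx n i).le]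
  exact ENNReal.ofReal_le_ofReal (h k)

/-- Dropping the positive remainder in `LinRec.eq_sum` leaves the partial sums. In particular, a
positive carrier forces `vmin` to be finite. -/
lemma LinRec.vmin_le {x : ℤ → ℝ × ℝ} {V : ℤ → ℝ} (hV : LinRec x V) (hx : Pos x)
    (hpos : ∀ n, 0 < V n) (n : ℤ) : vmin x n ≤ ENNReal.ofReal (V n) := by
  refine Toda.vmin_le hx n fun k => ?_
  have := hV.eq_sum n k
  have := mul_pos (ratioProd_pos hx n k) (hpos (n - k))
  linarith

lemma vmin_toReal_pos {x : ℤ → ℝ × ℝ} (hx : Pos x) {n : ℤ} (hn : vmin x n ≠ ∞) :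
    0 < (vmin x n).toReal := by
  have := sum_term_le_vmin hx n hn 1
  rw [Finset.sum_range_one] at this
  exact (term_pos hx n 0).trans_le this

lemma linRec_vmin {x : ℤ → ℝ × ℝ} (hx : Pos x) (h : ∀ n, vmin x n ≠ ∞) :
    LinRec x fun n => (vmin x n).toReal := by
  intro n
  have h1 := (hx (n + 1)).1
  have h2 := (hx n).2
  simp only
  rw [vmin_succ hx, ENNReal.toReal_add ENNReal.ofReal_ne_top
    (ENNReal.mul_ne_top ENNReal.ofReal_ne_top (h n)), ENNReal.toReal_mul,
    ENNReal.toReal_ofReal (by positivity), ENNReal.toReal_ofReal (by positivity)]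

/-- Applied to the difference of two solutions of the linear recursion: a small product means that
the difference is large far to the left. -/
lemma eq_ratioProd_mul {x : ℤ → ℝ × ℝ} {d : ℤ → ℝ}
    (hd : ∀ n, d (n + 1) = (x n).2 / (x (n + 1)).1 * d n) (n : ℤ) (k : ℕ) :
    d n = ratioProd x n k * d (n - k) := by
  induction k with
  | zero => simp [ratioProd]
  | succ k ih =>
    have h := hd (n - k - 1)
    rw [sub_add_cancel] at h
    rw [ih, h, ratioProd_succ']
    push_cast
    rw [← sub_sub]
    ring

lemma Regular.umin_pos {x : ℤ → ℝ × ℝ} (hx : Regular x) (n : ℤ) : 0 < umin x n :=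
  inv_pos.2 (vmin_toReal_pos hx.pos (hx.vmin_ne_top n))

lemma umin_succ {x : ℤ → ℝ × ℝ} (hx : Pos x) (h : ∀ n, vmin x n ≠ ∞) (n : ℤ) :
    umin x (n + 1) = (x (n + 1)).1 * umin x n * ((x n).2 + umin x n)⁻¹ := by
  have h1 := linRec_vmin hx h n
  have h2 := vmin_toReal_pos hx (h n)
  have h3 := (hx (n + 1)).1
  have h4 := (hx n).2
  simp only at h1
  rw [umin, umin, h1]
  field_simp
  ring

/-! ### Deterministic dynamics: reversal, uniqueness of the carrier, two-sided orbits -/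

section Solution

variable {w : TodaField}

/-- The solution `w`, observed from time `s` on. -/
def shift (w : TodaField) (s : ℤ) : TodaField where
  I t n := w.I (t + s) n
  J t n := w.J (t + s) n
  U t n := w.U (t + s) n

/-- Reversal of time and space. -/
def reverse (w : TodaField) : TodaField where
  I t n := w.I (-t) (-n)
  J t n := w.J (-t) (-n - 1)
  U t n := w.U (-t - 1) (-n)

lemma isSolution_shift (hw : w.IsSolution) (s : ℤ) : (shift w s).IsSolution where
  I_pos _ _ := hw.I_pos _ _
  J_pos _ _ := hw.J_pos _ _
  U_pos _ _ := hw.U_pos _ _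
  I_eq t n := by
    simp only [shift]
    rw [add_right_comm]
    exact hw.I_eq _ _
  J_eq t n := by
    simp only [shift]
    rw [add_right_comm]
    exact hw.J_eq _ _
  U_eq t n := by
    simp only [shift]
    rw [add_right_comm]
    exact hw.U_eq _ _

/-- The local map of the dynamics is an involution. -/
lemma local_involution {a b u a' b' u' : ℝ} (ha : 0 < a) (hb : 0 < b) (hu : 0 < u)
    (h1 : a' = b + u) (h2 : b' = a * b * a'⁻¹) (h3 : u' = a * u * a'⁻¹) :
    a = b' + u' ∧ b = a' * b' * a⁻¹ ∧ u = a' * u' * a⁻¹ := by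
  have : 0 < a' := by rw [h1]; positivity
  refine ⟨?_, ?_, ?_⟩
  · rw [h2, h3]
    field_simp
    rw [h1]
  · rw [h2]
    field_simp
  · rw [h3]
    field_simp

/-- The local map sends (I_{n+1}, J_n, U_n) at time t to I_n, J_n at time t+1 and U_{n+1} at time t.
Being an involution, it may be read backwards; the unit offsets in `reverse` align outputs with
inputs. -/
lemma isSolution_reverse (hw : w.IsSolution) : (reverse w).IsSolution := by
  have key : ∀ t n, _ := fun t n => local_involution (hw.I_pos (-t - 1) (-n - 1 + 1))
    (hw.J_pos (-t - 1) (-n - 1)) (hw.U_pos (-t - 1) (-n - 1)) (hw.I_eq _ _) (hw.J_eq _ _)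
    (hw.U_eq _ _)
  simp only [sub_add_cancel] at key
  have e : ∀ n : ℤ, -(n + 1) = -n - 1 := fun n => by ring
  refine ⟨fun _ _ => hw.I_pos _ _, fun _ _ => hw.J_pos _ _, fun _ _ => hw.U_pos _ _,
    fun t n => ?_, fun t n => ?_, fun t n => ?_⟩ <;> simp only [reverse, e]
  · exact (key t n).1
  · exact (key t n).2.1
  · exact (key t n).2.2

lemma config_pos (hw : w.IsSolution) (t : ℤ) : Pos (w.config t) :=
  fun n => ⟨hw.I_pos t n, hw.J_pos t n⟩

lemma linRec_inv (hw : w.IsSolution) (t : ℤ) : LinRec (w.config t) fun n => (w.U t n)⁻¹ := by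
  intro n
  have h1 := hw.I_pos t (n + 1)
  have h2 := hw.J_pos t n
  have h3 := hw.U_pos t n
  simp only [TodaField.config]
  rw [hw.U_eq, hw.I_eq]
  field_simp
  ring

lemma vmin_ne_top (hw : w.IsSolution) (t n : ℤ) : vmin (w.config t) n ≠ ∞ :=
  ne_top_of_le_ne_top ENNReal.ofReal_ne_top
    ((linRec_inv hw t).vmin_le (config_pos hw t) (fun m => inv_pos.2 (hw.U_pos t m)) n)

/-- At the new time J'_{m-1} = (U_m/U_{m-1}) J_{m-1} and I'_m = J_m (1 + U_m/J_m), so the ratios of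
carriers telescope and the old J's cancel. -/
lemma term_config_succ (hw : w.IsSolution) (t n : ℤ) (k : ℕ) :
    term (w.config (t + 1)) n k = (w.U t n / w.J t n) * (w.U t (n - k))⁻¹ *
      ∏ j ∈ Finset.range (k + 1), (1 + w.U t (n - j) / w.J t (n - j))⁻¹ := by
  induction k generalizing n with
  | zero =>
    have h2 := hw.J_pos t n
    have h3 := hw.U_pos t n
    simp only [term_zero, TodaField.config, hw.I_eq]
    simp
    field_simp
  | succ k ih =>
    have h1 := hw.I_pos t n
    have h2 := hw.J_pos t n
    have h3 := hw.U_pos t n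
    have h4 := hw.J_pos t (n - 1)
    have h5 := hw.U_pos t (n - 1)
    have e1 := hw.U_eq t (n - 1)
    have e2 := hw.J_eq t (n - 1)
    rw [sub_add_cancel] at e1 e2
    rw [term_succ, ih, Finset.prod_range_succ' _ (k + 1)]
    have e3 : w.I t n * (w.I (t + 1) (n - 1))⁻¹ = w.U t n / w.U t (n - 1) := by
      rw [e1]; field_simp
    have e4 : w.J (t + 1) (n - 1) = w.U t n / w.U t (n - 1) * w.J t (n - 1) := by
      rw [e2, ← e3]; ring
    have e5 : w.I (t + 1) n = w.J t n * (1 + w.U t n / w.J t n) := by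
      rw [hw.I_eq]; field_simp
    have e6 : ∀ j : ℕ, n - 1 - (j : ℤ) = n - ((j + 1 : ℕ) : ℤ) := fun j => by push_cast; ring
    simp only [TodaField.config, e4, e5, e6]
    have h6 : 0 < 1 + w.U t n / w.J t n := by positivity
    simp only [Nat.cast_zero, sub_zero]
    field_simp

/-- Uniqueness of the carrier: another carrier would obstruct the evolution at the next time. -/
lemma U_eq_umin (hw : w.IsSolution) (t : ℤ)
    (hs : ∀ ε > 0, ∃ k, ratioProd (w.config t) 0 k < ε) (n : ℤ) :
    w.U t n = umin (w.config t) n := by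
  set x := w.config t with hx
  have hpos : Pos x := config_pos hw t
  have hfin : ∀ n, vmin x n ≠ ∞ := vmin_ne_top hw t
  have hV := linRec_inv hw t
  have hm := linRec_vmin hpos hfin
  set d : ℤ → ℝ := fun n => (w.U t n)⁻¹ - (vmin x n).toReal with hd
  have hdrec : ∀ n, d (n + 1) = (x n).2 / (x (n + 1)).1 * d n := by
    intro n
    have h1 := hV n
    have h2 := hm n
    simp only at h1 h2
    simp only [hd]
    rw [h1, h2]
    ring
  have hdnn : ∀ n, 0 ≤ d n := by
    intro n
    refine sub_nonneg.2 (ENNReal.toReal_le_of_le_ofReal (inv_pos.2 (hw.U_pos t n)).le ?_)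
    exact hV.vmin_le hpos (fun m => inv_pos.2 (hw.U_pos t m)) n
  have hd0 : d 0 = 0 := by
    by_contra hne
    have hd0 : 0 < d 0 := lt_of_le_of_ne (hdnn 0) (Ne.symm hne)
    have hdle : ∀ n, d n ≤ (w.U t n)⁻¹ := fun n => sub_le_self _ ENNReal.toReal_nonneg
    -- From d ≤ 1/U and d_0 = term · J · d at the site -(k+1). Since the terms are summable, so is
    -- U/J to the left.
    have hbound : ∀ k : ℕ, w.U t (0 - ((k + 1 : ℕ) : ℤ)) / w.J t (0 - ((k + 1 : ℕ) : ℤ)) ≤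
        term x 0 k / d 0 := by
      intro k
      have h1 := eq_ratioProd_mul hdrec 0 (k + 1)
      rw [ratioProd_succ'] at h1
      have h2 := hdle (0 - ((k + 1 : ℕ) : ℤ))
      have e : (0 : ℤ) - k - 1 = 0 - ((k + 1 : ℕ) : ℤ) := by push_cast; ring
      rw [e] at h1
      set m := 0 - ((k + 1 : ℕ) : ℤ)
      have hU := hw.U_pos t m
      have hJ : 0 < w.J t m := hw.J_pos t m
      rw [le_div_iff₀ hd0, div_mul_eq_mul_div, div_le_iff₀ hJ]
      have hr := term_pos hpos 0 k
      have e2 : d 0 = term x 0 k * w.J t m * d m := by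
        rw [h1, term]
        simp only [hx, TodaField.config]
        ring
      rw [e2]
      have : w.U t m * d m ≤ 1 := by
        calc _ ≤ w.U t m * (w.U t m)⁻¹ := by gcongr
          _ = 1 := mul_inv_cancel₀ hU.ne'
      calc _ = (term x 0 k * w.J t m) * (w.U t m * d m) := by ring
        _ ≤ (term x 0 k * w.J t m) * 1 := by gcongr
        _ = _ := mul_one _
    -- The summand at site 0 is separate because `hbound` only covers the sites to its left.
    set C := w.U t 0 / w.J t 0 + (vmin x 0).toReal / d 0
    have hprod : ∀ k : ℕ, Real.exp (-C) ≤
        ∏ j ∈ Finset.range (k + 1), (1 + w.U t (0 - j) / w.J t (0 - j))⁻¹ := by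
      intro k
      have h1 : ∑ j ∈ Finset.range (k + 1), w.U t (0 - (j : ℤ)) / w.J t (0 - (j : ℤ)) ≤ C := by
        rw [Finset.sum_range_succ', add_comm]
        simp only [Nat.cast_zero, sub_zero, C]
        gcongr
        calc _ ≤ ∑ i ∈ Finset.range k, term x 0 i / d 0 := Finset.sum_le_sum fun i _ => hbound i
          _ = (∑ i ∈ Finset.range k, term x 0 i) / d 0 := by rw [Finset.sum_div]
          _ ≤ _ := by
            gcongr
            exact sum_term_le_vmin hpos 0 (hfin 0) k
      calc Real.exp (-C) ≤ Real.exp (-∑ j ∈ Finset.range (k + 1),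
            w.U t (0 - (j : ℤ)) / w.J t (0 - (j : ℤ))) := by gcongr
        _ = ∏ j ∈ Finset.range (k + 1),
            (Real.exp (w.U t (0 - (j : ℤ)) / w.J t (0 - (j : ℤ))))⁻¹ := by
          rw [← Finset.sum_neg_distrib, Real.exp_sum]
          simp only [Real.exp_neg]
        _ ≤ _ := by
          refine Finset.prod_le_prod (fun _ _ => by positivity) fun j _ => ?_
          have := div_pos (hw.U_pos t (0 - j)) (hw.J_pos t (0 - j))
          gcongr
          linarith [Real.add_one_le_exp (w.U t (0 - (j : ℤ)) / w.J t (0 - (j : ℤ)))]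
    have hU0 := hw.U_pos t 0
    have hJ0 := hw.J_pos t 0
    set K := (w.U t 0 / w.J t 0) * d 0 * Real.exp (-C)
    have hK : 0 < K := by positivity
    have hW := (vmin_ne_top hw (t + 1) 0)
    -- 1/U at -k is at least d_0 divided by the ratio product, and the product in `term_config_succ`
    -- stays above exp(-C). So the new term is at least K over the ratio product, yet at most the
    -- finite new `vmin`.
    have hup : ∀ k, K ≤ ratioProd x 0 k * (vmin (w.config (t + 1)) 0).toReal := by
      intro k
      have h1 : term (w.config (t + 1)) 0 k ≤ (vmin (w.config (t + 1)) 0).toReal := by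
        refine le_trans ?_ (sum_term_le_vmin (config_pos hw _) 0 hW (k + 1))
        exact Finset.single_le_sum (fun i _ => (term_pos (config_pos hw _) 0 i).le)
          (Finset.self_mem_range_succ k)
      rw [term_config_succ hw] at h1
      have h2 := hdle (0 - k)
      have h3 := ratioProd_pos hpos 0 k
      have h4 := eq_ratioProd_mul hdrec 0 k
      have h5 := hprod k
      have h6 := inv_pos.2 (hw.U_pos t (0 - k))
      calc K = (w.U t 0 / w.J t 0) * (ratioProd x 0 k * d (0 - k)) * Real.exp (-C) := by
            rw [← h4]
        _ ≤ (w.U t 0 / w.J t 0) * (ratioProd x 0 k * (w.U t (0 - k))⁻¹) *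
            ∏ j ∈ Finset.range (k + 1), (1 + w.U t (0 - j) / w.J t (0 - j))⁻¹ := by gcongr
        _ = ratioProd x 0 k * ((w.U t 0 / w.J t 0) * (w.U t (0 - k))⁻¹ *
            ∏ j ∈ Finset.range (k + 1), (1 + w.U t (0 - j) / w.J t (0 - j))⁻¹) := by ring
        _ ≤ _ := by gcongr
    have hWpos := vmin_toReal_pos (config_pos hw (t + 1)) hW
    obtain ⟨k, hk⟩ := hs (K / (vmin (w.config (t + 1)) 0).toReal) (div_pos hK hWpos)
    rw [lt_div_iff₀ hWpos] at hk
    exact absurd (hup k) (not_le.2 hk)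
  -- The homogeneous recursion has positive coefficients, so a zero propagates in both directions.
  have hdn : ∀ n, d n = 0 := by
    intro n
    induction n using Int.induction_on with
    | zero => exact hd0
    | succ i ih => rw [hdrec, ih, mul_zero]
    | pred i ih =>
      have := hdrec (-(i : ℤ) - 1)
      rw [sub_add_cancel, ih] at this
      have h := div_pos (hpos (-(i : ℤ) - 1)).2 (hpos (-(i : ℤ))).1
      exact (mul_eq_zero.1 this.symm).resolve_left h.ne'
  rw [umin, ← sub_eq_zero.1 (hdn n), inv_inv]

lemma config_succ (hw : w.IsSolution) (t : ℤ)
    (hs : ∀ ε > 0, ∃ k, ratioProd (w.config t) 0 k < ε) :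
    w.config (t + 1) = evolve (w.config t) := by
  funext n
  have h := U_eq_umin hw t hs n
  simp only [evolve, ← h]
  simp only [TodaField.config, hw.I_eq, hw.J_eq]

lemma config_reverse (t : ℤ) : (reverse w).config t = reflect (w.config (-t)) := rfl

lemma forward_unique (hw : w.IsSolution) {x : ℤ → ℝ × ℝ} (h0 : w.config 0 = x)
    (hreg : ∀ k, Regular (evolve^[k] x)) (t : ℕ) :
    w.config t = evolve^[t] x ∧ ∀ n, w.U t n = umin (evolve^[t] x) n := by
  have h : w.config t = evolve^[t] x := by
    induction t with
    | zero => exact h0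
    | succ t ih =>
      rw [Nat.cast_succ, config_succ hw, ih, Function.iterate_succ_apply']
      rw [ih]
      exact (hreg t).ratioProd_small
  refine ⟨h, fun n => ?_⟩
  rw [← h]
  refine U_eq_umin hw t ?_ n
  rw [h]
  exact (hreg t).ratioProd_small

/-- The two-sided orbit of `x`, with carriers `umin`. -/
noncomputable def orbit (x : ℤ → ℝ × ℝ) : TodaField where
  I t n := match t with
    | Int.ofNat t => (evolve^[t] x n).1
    | Int.negSucc t => (reflect (evolve^[t + 1] (reflect x)) n).1
  J t n := match t with
    | Int.ofNat t => (evolve^[t] x n).2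
    | Int.negSucc t => (reflect (evolve^[t + 1] (reflect x)) n).2
  U t n := match t with
    | Int.ofNat t => umin (evolve^[t] x) n
    | Int.negSucc t => umin (evolve^[t] (reflect x)) (-n)

/-- The seam of the orbit: for `t = 0` the time is 0, which belongs to the nonnegative branch of the
definition. -/
lemma orbit_neg (x : ℤ → ℝ × ℝ) (t : ℕ) (n : ℤ) :
    (orbit x).I (Int.negSucc t + 1) n = (evolve^[t] (reflect x) (-n)).1 ∧
      (orbit x).J (Int.negSucc t + 1) n = (evolve^[t] (reflect x) (-n - 1)).2 := by
  cases t with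
  | zero => simp [orbit, reflect]
  | succ t => exact ⟨rfl, rfl⟩

lemma isSolution_orbit {x : ℤ → ℝ × ℝ} (h1 : ∀ k, Regular (evolve^[k] x))
    (h2 : ∀ k, Regular (evolve^[k] (reflect x))) : (orbit x).IsSolution := by
  have key : ∀ t n, _ := fun t n => local_involution ((h2 t).pos (-n - 1 + 1)).1
    ((h2 t).pos (-n - 1)).2 ((h2 t).umin_pos (-n - 1)) rfl rfl
    (umin_succ (h2 t).pos (h2 t).vmin_ne_top (-n - 1))
  simp only [sub_add_cancel] at key
  have e : ∀ n : ℤ, -(n + 1) = -n - 1 := fun n => by ring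
  constructor
  · rintro (t | t) n
    · exact ((h1 t).pos n).1
    · exact ((h2 (t + 1)).pos (-n)).1
  · rintro (t | t) n
    · exact ((h1 t).pos n).2
    · exact ((h2 (t + 1)).pos (-n - 1)).2
  · rintro (t | t) n
    · exact (h1 t).umin_pos n
    · exact (h2 t).umin_pos (-n)
  · rintro (t | t) n
    · change (evolve^[t + 1] x n).1 = _
      rw [Function.iterate_succ_apply']
      rfl
    · rw [(orbit_neg x t n).1, (key t n).1]
      simp only [orbit, reflect, Function.iterate_succ_apply']
      simp [evolve]
  · rintro (t | t) n
    · change (evolve^[t + 1] x n).2 = (evolve^[t] x (n + 1)).1 * (evolve^[t] x n).2 *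
        (evolve^[t + 1] x n).1⁻¹
      rw [Function.iterate_succ_apply']
      rfl
    · rw [(orbit_neg x t n).1, (orbit_neg x t n).2, (key t n).2.1]
      simp only [orbit, reflect, Function.iterate_succ_apply', e]
      simp [evolve]
  · rintro (t | t) n
    · change umin _ _ = (evolve^[t] x (n + 1)).1 * umin _ _ * (evolve^[t + 1] x n).1⁻¹
      rw [Function.iterate_succ_apply']
      exact umin_succ (h1 t).pos (h1 t).vmin_ne_top n
    · rw [(orbit_neg x t n).1]
      simp only [orbit, reflect, Function.iterate_succ_apply', e]
      rw [(key t n).2.2]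
      simp [evolve]

/-- Forward uniqueness, applied to the solution and to its reversal, fixes both halves. -/
lemma orbit_unique {x : ℤ → ℝ × ℝ} (h1 : ∀ k, Regular (evolve^[k] x))
    (h2 : ∀ k, Regular (evolve^[k] (reflect x))) (hw : w.SolvesIVP x) : w = orbit x := by
  have hf := forward_unique hw.1 hw.2 h1
  have hb := forward_unique (isSolution_reverse hw.1) (x := reflect x)
    (by rw [config_reverse, neg_zero, hw.2]) h2
  have hc : ∀ t n, w.config t n = ((orbit x).I t n, (orbit x).J t n) := by
    rintro (t | t) n
    · exact congrFun (hf t).1 n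
    · have := (hb (t + 1)).1
      rw [config_reverse] at this
      have h := congrArg reflect this
      rw [reflect_reflect] at h
      exact congrFun h n
  ext t n
  · exact congrArg Prod.fst (hc t n)
  · exact congrArg Prod.snd (hc t n)
  · rcases t with t | t
    · exact (hf t).2 n
    · have := (hb t).2 (-n)
      simp only [reverse, neg_neg] at this
      rw [Int.negSucc_eq, neg_add, ← sub_eq_add_neg, this]
      rw [show -(t : ℤ) - 1 = Int.negSucc t by rw [Int.negSucc_eq]; ring]
      rfl

lemma mem_todaDomain_of_regular {x : ℤ → ℝ × ℝ} (h1 : ∀ k, Regular (evolve^[k] x))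
    (h2 : ∀ k, Regular (evolve^[k] (reflect x))) : x ∈ todaDomain :=
  ⟨orbit x, ⟨isSolution_orbit h1 h2, rfl⟩, fun _ hw => orbit_unique h1 h2 hw⟩

lemma todaStep_eq_evolve {x : ℤ → ℝ × ℝ} (hx : x ∈ todaDomain)
    (hs : ∀ ε > 0, ∃ k, ratioProd x 0 k < ε) : todaStep x = evolve x := by
  rw [todaStep, dif_pos hx]
  have h := (Exists.choose_spec hx).1
  have h3 := h.2
  have h2 := config_succ h.1 0 (by rw [h3]; exact hs)
  rw [h3] at h2
  exact h2

end Solution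

/-! ### Driving inputs and measurability with respect to the past -/

/-- The pairs of variables that drive the carrier: `(I_{n+1}, J_n)`. -/
def drive (x : ℤ → ℝ × ℝ) : ℤ → ℝ × ℝ := fun n => ((x (n + 1)).1, (x n).2)

/-- The law of an i.i.d. sequence of independent pairs with marginals `μ` and `ν`. -/
noncomputable def siteLaw (μ ν : Measure ℝ) : Measure (ℤ → ℝ × ℝ) :=
  Measure.infinitePi fun _ => μ.prod ν

/-- The history of the driving pairs strictly to the left of `n`. -/
@[reducible]
def past (n : ℤ) : MeasurableSpace (ℤ → ℝ × ℝ) :=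
  ⨆ j ∈ Set.Iio n, MeasurableSpace.comap (fun x => drive x j) inferInstance

section Measurability

@[fun_prop]
lemma measurable_drive : Measurable drive := by
  unfold drive; fun_prop

@[fun_prop]
lemma measurable_reflect : Measurable reflect := by
  unfold reflect; fun_prop

lemma past_le (n : ℤ) : past n ≤ MeasurableSpace.pi :=
  iSup₂_le fun j _ => Measurable.comap_le (by fun_prop)

lemma past_mono {m n : ℤ} (h : m ≤ n) : past m ≤ past n :=
  biSup_mono fun _ hj => lt_of_lt_of_le hj h

lemma measurable_drive_past {j n : ℤ} (h : j < n) : Measurable[past n] fun x => drive x j :=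
  Measurable.mono (comap_measurable _)
    (le_iSup₂_of_le (f := fun j (_ : j ∈ Set.Iio n) =>
      MeasurableSpace.comap (fun x => drive x j) inferInstance) j h le_rfl) le_rfl

/-- The endpoint `j = n` is allowed because `drive` pairs I_{j} with J_{j-1}. -/
lemma measurable_fst_past {j n : ℤ} (h : j ≤ n) : Measurable[past n] fun x => (x j).1 := by
  have := (measurable_drive_past (j := j - 1) (n := n) (by omega)).fst
  simpa [drive] using this

lemma measurable_snd_past {j n : ℤ} (h : j < n) : Measurable[past n] fun x => (x j).2 :=
  (measurable_drive_past h).snd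

lemma measurable_ratioProd_past (n : ℤ) (k : ℕ) :
    Measurable[past n] fun x => ratioProd x n k := by
  induction k generalizing n with
  | zero => exact measurable_const
  | succ k ih =>
    exact ((measurable_snd_past (by omega)).div (measurable_fst_past le_rfl)).mul
      ((ih (n - 1)).mono (past_mono (by omega)) le_rfl)

lemma measurable_term_past (n : ℤ) (k : ℕ) : Measurable[past n] fun x => term x n k :=
  (measurable_ratioProd_past n k).div (measurable_fst_past (by omega))

lemma measurable_vmin_past (n : ℤ) : Measurable[past n] fun x => vmin x n := by
  let _ : MeasurableSpace (ℤ → ℝ × ℝ) := past n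
  exact Measurable.tsum fun k => (measurable_term_past n k).ennreal_ofReal

/-- Together with `indep_drive_past` this makes the carrier at `n` independent of the input it meets
there. -/
lemma measurable_umin_past (n : ℤ) : Measurable[past n] fun x => umin x n :=
  (measurable_vmin_past n).ennreal_toReal.inv

lemma measurable_evolve_past {i n : ℤ} (h : i < n) : Measurable[past n] fun x => evolve x i := by
  have h1 := measurable_snd_past h
  have h2 : Measurable[past n] fun x => umin x i :=
    (measurable_umin_past i).mono (past_mono h.le) le_rfl
  have h3 := measurable_fst_past (j := i + 1) (n := n) (by omega)
  exact (h1.add h2).prodMk ((h3.mul h1).mul (h1.add h2).inv)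

@[fun_prop]
lemma measurable_ratioProd (n : ℤ) (k : ℕ) : Measurable fun x => ratioProd x n k :=
  (measurable_ratioProd_past n k).mono (past_le n) le_rfl

@[fun_prop]
lemma measurable_term (n : ℤ) (k : ℕ) : Measurable fun x => term x n k :=
  (measurable_term_past n k).mono (past_le n) le_rfl

@[fun_prop]
lemma measurable_vmin (n : ℤ) : Measurable fun x => vmin x n :=
  (measurable_vmin_past n).mono (past_le n) le_rfl

@[fun_prop]
lemma measurable_umin (n : ℤ) : Measurable fun x => umin x n :=
  (measurable_umin_past n).mono (past_le n) le_rfl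

@[fun_prop]
lemma measurable_evolve : Measurable evolve :=
  measurable_pi_iff.2 fun i => (measurable_evolve_past (lt_add_one i)).mono (past_le _) le_rfl

end Measurability

/-! ### The product law: reindexing, independence, decay of the ratio products -/

section Law

variable {μ ν : Measure ℝ} [IsProbabilityMeasure μ] [IsProbabilityMeasure ν]

instance : IsProbabilityMeasure (siteLaw μ ν) := by unfold siteLaw; infer_instance

/-- The law of all the variables, as a single family. -/
noncomputable def flatLaw (μ ν : Measure ℝ) : Measure (ℤ × Bool → ℝ) :=
  Measure.infinitePi fun p => if p.2 then μ else ν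

instance (b : Bool) : IsProbabilityMeasure (if b then μ else ν) := by
  split_ifs <;> infer_instance

lemma flatLaw_map_pair :
    (flatLaw μ ν).map (fun z n => (z (n, true), z (n, false))) = siteLaw μ ν := by
  have h := Measure.infinitePi_map_curry (fun (_ : ℤ) (b : Bool) => if b then μ else ν)
  have h2 := Measure.infinitePi_map_pi
    (μ := fun _ : ℤ => Measure.infinitePi fun b : Bool => if b then μ else ν)
    (f := fun _ (g : Bool → ℝ) => (g true, g false)) (fun _ => by fun_prop)
  rw [← h, Measure.map_map (by fun_prop) (by fun_prop)] at h2
  simp only [Measure.infinitePi_map_eval_prod (P := fun b : Bool => if b then μ else ν)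
    (show true ≠ false by decide)] at h2
  exact h2

/-- `reflect` and `drive` move the I's and the J's by different maps, so the pairs are split into a
single independent family first. -/
lemma flatLaw_map_reindex {f g : ℤ → ℤ} (hf : Function.Injective f) (hg : Function.Injective g) :
    (flatLaw μ ν).map (fun z n => (z (f n, true), z (g n, false))) = siteLaw μ ν := by
  let s : ℤ × Bool → ℤ × Bool := fun p => (if p.2 then f p.1 else g p.1, p.2)
  have hs : Function.Injective s := by
    rintro ⟨n, b⟩ ⟨m, c⟩ h
    simp only [s, Prod.mk.injEq] at h
    obtain ⟨h1, rfl⟩ := h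
    cases b
    · simpa using hg (by simpa using h1)
    · simpa using hf (by simpa using h1)
  have h := Measure.map_infinitePi_infinitePi_of_inj
    (P := fun p : ℤ × Bool => if p.2 then μ else ν) hs
  change (flatLaw μ ν).map _ = flatLaw μ ν at h
  conv_rhs => rw [← flatLaw_map_pair, ← h]
  rw [Measure.map_map (by fun_prop) (by fun_prop)]
  rfl

lemma siteLaw_map_reindex {f g : ℤ → ℤ} (hf : Function.Injective f) (hg : Function.Injective g) :
    (siteLaw μ ν).map (fun x n => ((x (f n)).1, (x (g n)).2)) = siteLaw μ ν := by
  conv_lhs => rw [← flatLaw_map_pair]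
  rw [Measure.map_map (by fun_prop) (by fun_prop)]
  exact flatLaw_map_reindex hf hg

lemma siteLaw_map_reflect : (siteLaw μ ν).map reflect = siteLaw μ ν :=
  siteLaw_map_reindex neg_injective fun a b h => by simpa using h

lemma siteLaw_map_drive : (siteLaw μ ν).map drive = siteLaw μ ν :=
  siteLaw_map_reindex (add_left_injective 1) Function.injective_id

lemma siteLaw_map_eval (n : ℤ) : (siteLaw μ ν).map (fun x => x n) = μ.prod ν :=
  Measure.infinitePi_map_eval _ n

lemma siteLaw_map_drive_eval (n : ℤ) : (siteLaw μ ν).map (fun x => drive x n) = μ.prod ν := by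
  have h := siteLaw_map_eval (μ := μ) (ν := ν) n
  rw [← siteLaw_map_drive, Measure.map_map (by fun_prop) (by fun_prop)] at h
  exact h

lemma siteLaw_map_fst (n : ℤ) : (siteLaw μ ν).map (fun x => (x n).1) = μ := by
  have := congrArg (Measure.map Prod.fst) (siteLaw_map_eval (μ := μ) (ν := ν) n)
  rw [Measure.map_map (by fun_prop) (by fun_prop), Measure.map_fst_prod, measure_univ, one_smul]
    at this
  exact this

lemma siteLaw_map_snd (n : ℤ) : (siteLaw μ ν).map (fun x => (x n).2) = ν := by
  have := congrArg (Measure.map Prod.snd) (siteLaw_map_eval (μ := μ) (ν := ν) n)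
  rw [Measure.map_map (by fun_prop) (by fun_prop), Measure.map_snd_prod, measure_univ, one_smul]
    at this
  exact this

lemma iIndepFun_eval : iIndepFun (fun (n : ℤ) (x : ℤ → ℝ × ℝ) => x n) (siteLaw μ ν) :=
  iIndepFun_infinitePi (X := fun _ y => y) (fun _ => measurable_id)

lemma iIndepFun_drive : iIndepFun (fun n x => drive x n) (siteLaw μ ν) := by
  rw [iIndepFun_iff_map_fun_eq_infinitePi_map (by fun_prop)]
  simp only [siteLaw_map_drive_eval]
  exact siteLaw_map_drive

lemma indep_drive_past (n : ℤ) :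
    Indep (MeasurableSpace.comap (fun x => drive x n) inferInstance) (past n) (siteLaw μ ν) := by
  have h := indep_iSup_of_disjoint (S := {n}) (T := Set.Iio n)
    (m := fun j : ℤ => MeasurableSpace.comap (fun x : ℤ → ℝ × ℝ => drive x j) inferInstance)
    (fun j => Measurable.comap_le (by fun_prop)) (iIndepFun_drive (μ := μ) (ν := ν)).iIndep
    (by simp)
  simpa [past] using h

lemma ae_pos (hμ : ∀ᵐ a ∂μ, 0 < a) (hν : ∀ᵐ a ∂ν, 0 < a) : ∀ᵐ x ∂siteLaw μ ν, Pos x := by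
  refine ae_all_iff.2 fun n => ?_
  rw [← siteLaw_map_fst (μ := μ) (ν := ν) n] at hμ
  rw [← siteLaw_map_snd (μ := μ) (ν := ν) n] at hν
  filter_upwards [ae_of_ae_map (Measurable.aemeasurable (by fun_prop)) hμ,
    ae_of_ae_map (Measurable.aemeasurable (by fun_prop)) hν] with x h1 h2
  exact ⟨h1, h2⟩

lemma term_tendsto_zero {x : ℤ → ℝ × ℝ} (hx : Pos x) {n : ℤ} (h : vmin x n ≠ ∞) :
    Tendsto (term x n) atTop (𝓝 0) := by
  have h1 := ENNReal.tendsto_atTop_zero_of_tsum_ne_top h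
  have h2 := (ENNReal.tendsto_toReal ENNReal.zero_ne_top).comp h1
  refine h2.congr fun k => ?_
  exact ENNReal.toReal_ofReal (term_pos hx n k).le

/-- The ratio product is the term times I_{n-k}. Terms of a convergent series tend to zero, and
I_{n-k} is tight because its law does not depend on k. As I may be unbounded, this yields
convergence in probability only, which still provides an almost surely convergent subsequence. -/
lemma tendstoInMeasure_ratioProd (hpos : ∀ᵐ x ∂siteLaw μ ν, Pos x) (n : ℤ)
    (hfin : ∀ᵐ x ∂siteLaw μ ν, vmin x n ≠ ∞) :
    TendstoInMeasure (siteLaw μ ν) (fun k x => ratioProd x n k) atTop (fun _ => 0) := by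
  have hterm : TendstoInMeasure (siteLaw μ ν) (fun k x => term x n k) atTop (fun _ => 0) := by
    refine tendstoInMeasure_of_tendsto_ae (fun k => by fun_prop) ?_
    filter_upwards [hpos, hfin] with x h1 h2
    exact term_tendsto_zero h1 h2
  rw [tendstoInMeasure_iff_norm] at hterm ⊢
  simp only [sub_zero] at hterm ⊢
  intro ε hε
  have htail : Tendsto (fun M : ℕ => μ (Set.Ioi (M : ℝ))) atTop (𝓝 0) := by
    have h : ⋂ M : ℕ, Set.Ioi (M : ℝ) = ∅ := by
      ext a
      simp only [Set.mem_iInter, Set.mem_Ioi, Set.mem_empty_iff_false, iff_false, not_forall,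
        not_lt]
      exact exists_nat_ge a
    rw [← measure_empty (μ := μ), ← h]
    refine tendsto_measure_iInter_atTop
      (fun M => measurableSet_Ioi.nullMeasurableSet) ?_
      ⟨0, measure_ne_top _ _⟩
    exact fun a b hab => Set.Ioi_subset_Ioi (Nat.cast_le.2 hab)
  rw [ENNReal.tendsto_atTop_zero] at htail ⊢
  intro η hη
  obtain ⟨M, hM⟩ := htail (η / 2) (ENNReal.half_pos hη.ne')
  have hM := hM (M + 1) (by omega)
  have hM1 : (0 : ℝ) < ((M + 1 : ℕ) : ℝ) := by positivity
  obtain ⟨N, hN⟩ := ENNReal.tendsto_atTop_zero.1 (hterm (ε / ((M + 1 : ℕ) : ℝ)) (by positivity))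
    (η / 2) (ENNReal.half_pos hη.ne')
  refine ⟨N, fun k hk => ?_⟩
  have hI : siteLaw μ ν {x | ((M + 1 : ℕ) : ℝ) < (x (n - k)).1} ≤ η / 2 := by
    rw [← siteLaw_map_fst (μ := μ) (ν := ν) (n - k),
      Measure.map_apply (by fun_prop) measurableSet_Ioi] at hM
    exact hM
  calc siteLaw μ ν {x | ε ≤ ‖ratioProd x n k‖}
      ≤ siteLaw μ ν ({x | ε / ((M + 1 : ℕ) : ℝ) ≤ ‖term x n k‖} ∪
          {x | ((M + 1 : ℕ) : ℝ) < (x (n - k)).1}) := by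
        refine measure_mono_ae ?_
        filter_upwards [hpos] with x hx h
        change ε ≤ ‖ratioProd x n k‖ at h
        by_contra hcon
        change ¬ (_ ∨ _) at hcon
        simp only [not_or, Set.mem_ofPred_eq, not_le, not_lt] at hcon
        have h1 := ratioProd_pos hx n k
        have h2 := (hx (n - k)).1
        rw [Real.norm_of_nonneg (term_pos hx n k).le, term, div_lt_div_iff₀ h2 hM1] at hcon
        rw [Real.norm_of_nonneg h1.le] at h
        have := mul_le_mul h hcon.2 h2.le h1.le
        linarith [hcon.1]
    _ ≤ η / 2 + η / 2 := (measure_union_le _ _).trans (add_le_add (hN k hk) hI)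
    _ = η := ENNReal.add_halves η

lemma ae_ratioProd_small (hpos : ∀ᵐ x ∂siteLaw μ ν, Pos x) (n : ℤ)
    (hfin : ∀ᵐ x ∂siteLaw μ ν, vmin x n ≠ ∞) :
    ∀ᵐ x ∂siteLaw μ ν, ∀ ε > 0, ∃ k, ratioProd x n k < ε := by
  obtain ⟨ns, -, h⟩ := (tendstoInMeasure_ratioProd hpos n hfin).exists_seq_tendsto_ae
  filter_upwards [h] with x hx ε hε
  obtain ⟨i, hi⟩ := (hx.eventually (gt_mem_nhds hε)).exists
  exact ⟨_, hi⟩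

lemma ae_regular (hpos : ∀ᵐ x ∂siteLaw μ ν, Pos x)
    (hfin : ∀ᵐ x ∂siteLaw μ ν, ∀ n, vmin x n ≠ ∞) : ∀ᵐ x ∂siteLaw μ ν, Regular x := by
  filter_upwards [hpos, hfin, ae_ratioProd_small hpos 0 (hfin.mono fun x h => h 0)]
    with x h1 h2 h3
  exact ⟨h1, h2, h3⟩

end Law

/-! ### A Burke property for carriers driven by independent inputs -/

/-- The local map: `((I_{n+1}, J_n), U_n) ↦ ((I'_n, J'_n), U_{n+1})`. -/
noncomputable def localMap (p : (ℝ × ℝ) × ℝ) : (ℝ × ℝ) × ℝ :=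
  ((p.1.2 + p.2, p.1.1 * p.1.2 * (p.1.2 + p.2)⁻¹), p.1.1 * p.2 * (p.1.2 + p.2)⁻¹)

@[fun_prop]
lemma measurable_localMap : Measurable localMap := by
  unfold localMap; fun_prop

section Burke

variable {Ω : Type*} {mΩ : MeasurableSpace Ω} {P : Measure Ω} {μ : Measure (ℝ × ℝ)} {γ : Measure ℝ} [IsProbabilityMeasure μ] [IsProbabilityMeasure γ]

/-- If the local map preserves `μ × γ`, then driving a carrier started from `γ` by independent
inputs with law `μ` produces independent outputs with law `μ`, independent of the carrier. -/
lemma burke {F : (ℝ × ℝ) × ℝ → (ℝ × ℝ) × ℝ} (hFm : Measurable F)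
    (hF : (μ.prod γ).map F = μ.prod γ) {ξ Y : ℕ → Ω → ℝ × ℝ} {U : ℕ → Ω → ℝ}
    {𝓕 : ℕ → MeasurableSpace Ω} (h𝓕 : ∀ k, 𝓕 k ≤ mΩ) (hξ : ∀ k, Measurable (ξ k))
    (hξlaw : ∀ k, P.map (ξ k) = μ)
    (hind : ∀ k, Indep (MeasurableSpace.comap (ξ k) inferInstance) (𝓕 k) P)
    (hU : ∀ k, Measurable[𝓕 k] (U k)) (hY : ∀ k, ∀ i < k, Measurable[𝓕 k] (Y i))
    (hstep : ∀ k, ∀ᵐ ω ∂P, F (ξ k ω, U k ω) = (Y k ω, U (k + 1) ω)) (hU0 : P.map (U 0) = γ)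
    {A : ℕ → Set (ℝ × ℝ)} (hA : ∀ i, MeasurableSet (A i)) (k : ℕ) {B : Set ℝ}
    (hB : MeasurableSet B) :
    P ((⋂ i ∈ Finset.range k, Y i ⁻¹' A i) ∩ U k ⁻¹' B) =
      (∏ i ∈ Finset.range k, μ (A i)) * γ B := by
  have hUm : ∀ k, Measurable (U k) := fun k => (hU k).mono (h𝓕 k) le_rfl
  induction k generalizing B with
  | zero => simp [← hU0, Measure.map_apply (hUm 0) hB]
  | succ k ih =>
    set E := ⋂ i ∈ Finset.range k, Y i ⁻¹' A i with hE
    have hEF : MeasurableSet[𝓕 k] E :=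
      Finset.measurableSet_biInter _ fun i hi => hY k i (Finset.mem_range.1 hi) (hA i)
    set c := ∏ i ∈ Finset.range k, μ (A i) with hc
    have hcfin : c ≠ ∞ := ENNReal.prod_ne_top fun i _ => measure_ne_top _ _
    -- On the event `E` about earlier outputs, the carrier has law `c • γ` by induction, and the
    -- fresh input is independent of `E` and the carrier. Applying `F` then moves the product
    -- structure one site on.
    have hprod : (P.restrict E).map (fun ω => (ξ k ω, U k ω)) = c • μ.prod γ := by
      have : IsFiniteMeasure (c • γ) := Measure.smul_finite γ hcfin
      rw [← Measure.prod_smul_right]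
      symm
      refine Measure.prod_eq fun s t hs ht => ?_
      have hpre : MeasurableSet[𝓕 k] (E ∩ U k ⁻¹' t) := hEF.inter (hU k ht)
      rw [Measure.map_apply ((hξ k).prodMk (hUm k)) (hs.prod ht),
        Measure.restrict_apply (((hξ k).prodMk (hUm k)) (hs.prod ht))]
      have e : (fun ω => (ξ k ω, U k ω)) ⁻¹' s ×ˢ t ∩ E = ξ k ⁻¹' s ∩ (E ∩ U k ⁻¹' t) := by
        ext ω
        simp only [Set.mem_inter_iff, Set.mem_preimage, Set.mem_prod]
        tauto
      rw [e, ((Indep_iff _ _ _).1 (hind k)) _ _ ⟨s, hs, rfl⟩ hpre, ih ht,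
        ← Measure.map_apply (hξ k) hs, hξlaw, Measure.smul_apply, smul_eq_mul]
    have hprod2 : (P.restrict E).map (fun ω => (Y k ω, U (k + 1) ω)) = c • μ.prod γ := by
      have h1 := congrArg (Measure.map F) hprod
      rw [Measure.map_map hFm ((hξ k).prodMk (hUm k)), Measure.map_smul, hF] at h1
      rw [← h1]
      refine Measure.map_congr (ae_restrict_of_ae ?_)
      filter_upwards [hstep k] with ω h using h.symm
    have hYm : Measurable (Y k) := (hY (k + 1) k (Nat.lt_succ_self k)).mono (h𝓕 _) le_rfl
    have h2 := congrArg (fun m => m (A k ×ˢ B)) hprod2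
    rw [Measure.map_apply (hYm.prodMk (hUm (k + 1))) ((hA k).prod hB),
      Measure.restrict_apply ((hYm.prodMk (hUm (k + 1))) ((hA k).prod hB)), Measure.smul_apply,
      Measure.prod_prod, smul_eq_mul, ← mul_assoc] at h2
    rw [Finset.prod_range_succ, ← hc, ← h2, Finset.range_add_one, Finset.set_biInter_insert]
    congr 1
    ext ω
    simp only [Set.mem_inter_iff, Set.mem_preimage, Set.mem_prod, ← hE]
    tauto

end Burke

/-- Adjoining an independent variable to a σ-algebra preserves independence. -/
lemma indep_comap_fst_prod {Ω : Type*} {m₁ m₂ : MeasurableSpace Ω} {mΩ : MeasurableSpace Ω}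
    {P : Measure Ω} [IsProbabilityMeasure P] {γ : Measure ℝ} [IsProbabilityMeasure γ] (h₁ : m₁ ≤ mΩ) (h₂ : m₂ ≤ mΩ)
    (h : Indep m₁ m₂ P) :
    Indep (m₁.comap Prod.fst) (@Prod.instMeasurableSpace Ω ℝ m₂ _) (P.prod γ) := by
  have hle : @Prod.instMeasurableSpace Ω ℝ m₂ _ ≤ Prod.instMeasurableSpace :=
    sup_le_sup (MeasurableSpace.comap_mono h₂) le_rfl
  have hpi : @IsPiSystem (Ω × ℝ) {s | MeasurableSet[m₁.comap Prod.fst] s} := by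
    intro s hs t ht _
    exact @MeasurableSet.inter _ (m₁.comap Prod.fst) s t hs ht
  refine IndepSets.indep ((MeasurableSpace.comap_mono h₁).trans le_sup_left) hle hpi
    (@isPiSystem_prod Ω ℝ m₂ _)
    (@MeasurableSpace.generateFrom_measurableSet _ (m₁.comap Prod.fst)).symm
    (@generateFrom_prod Ω ℝ m₂ _).symm ?_
  rw [IndepSets_iff]
  rintro _ _ ⟨s, hs, rfl⟩ ⟨a, ha, b, hb, rfl⟩
  have e1 : (Prod.fst : Ω × ℝ → Ω) ⁻¹' s = s ×ˢ Set.univ := by ext; simp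
  have e2 : (Prod.fst : Ω × ℝ → Ω) ⁻¹' s ∩ a ×ˢ b = (s ∩ a) ×ˢ b := by
    ext; simp [and_assoc]
  rw [e2, e1, Measure.prod_prod, Measure.prod_prod, Measure.prod_prod, measure_univ, mul_one,
    (Indep_iff _ _ _).1 h s a hs ha, mul_assoc]

/-! ### Stationary carriers: finiteness, law of `umin`, invariance of the configuration -/

/-- The carrier started at site `m` with value `u`, after `k` steps. -/
noncomputable def carrier (x : ℤ → ℝ × ℝ) (m : ℤ) (u : ℝ) : ℕ → ℝ
  | 0 => u
  | k + 1 => (x (m + k + 1)).1 * carrier x m u k * ((x (m + k)).2 + carrier x m u k)⁻¹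

lemma carrier_pos {x : ℤ → ℝ × ℝ} (hx : Pos x) (m : ℤ) {u : ℝ} (hu : 0 < u) (k : ℕ) :
    0 < carrier x m u k := by
  induction k with
  | zero => exact hu
  | succ k ih =>
    have h1 := (hx (m + k + 1)).1
    have h2 := (hx (m + k)).2
    rw [carrier]; positivity

/-- The linear recursion unrolled to the starting site: the initial value enters only through a
remainder weighted by the ratio product. -/
lemma inv_carrier {x : ℤ → ℝ × ℝ} (hx : Pos x) (m : ℤ) {u : ℝ} (hu : 0 < u) (k : ℕ) :
    (carrier x m u k)⁻¹ =
      ∑ i ∈ Finset.range k, term x (m + k) i + ratioProd x (m + k) k * u⁻¹ := by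
  induction k with
  | zero => simp [carrier, ratioProd]
  | succ k ih =>
    have h1 := (hx (m + k + 1)).1
    have h2 := (hx (m + k)).2
    have h3 := carrier_pos hx m hu k
    have e : (carrier x m u (k + 1))⁻¹ =
        (x (m + k + 1)).1⁻¹ + (x (m + k)).2 / (x (m + k + 1)).1 * (carrier x m u k)⁻¹ := by
      rw [carrier]; field_simp; ring
    rw [e, ih, Finset.sum_range_succ', ratioProd]
    push_cast
    simp only [term_succ, term_zero, ← add_assoc, add_sub_cancel_right]
    rw [← Finset.mul_sum]
    ring

lemma measurable_carrier (m : ℤ) (k : ℕ) :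
    Measurable[@Prod.instMeasurableSpace _ ℝ (past (m + k)) _]
      fun p : (ℤ → ℝ × ℝ) × ℝ => carrier p.1 m p.2 k := by
  induction k with
  | zero =>
    let _ : MeasurableSpace (ℤ → ℝ × ℝ) := past (m + (0 : ℕ))
    exact measurable_snd
  | succ k ih =>
    have hle : past (m + k) ≤ past (m + (k + 1 : ℕ)) := past_mono (by omega)
    have ih' := ih.mono (sup_le_sup (MeasurableSpace.comap_mono hle) le_rfl) le_rfl
    have h1 : Measurable[past (m + (k + 1 : ℕ))] fun x : ℤ → ℝ × ℝ => (x (m + k + 1)).1 :=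
      measurable_fst_past (by omega)
    have h2 : Measurable[past (m + (k + 1 : ℕ))] fun x : ℤ → ℝ × ℝ => (x (m + k)).2 :=
      measurable_snd_past (by omega)
    let _ : MeasurableSpace (ℤ → ℝ × ℝ) := past (m + (k + 1 : ℕ))
    exact ((h1.comp measurable_fst).mul ih').mul ((h2.comp measurable_fst).add ih').inv

section Stationary

variable {μ ν γ : Measure ℝ} [IsProbabilityMeasure μ] [IsProbabilityMeasure ν]
  [IsProbabilityMeasure γ]

/-- `burke` with no condition on the outputs. The initial value is an extra coordinate independent
of the configuration, so it is adjoined to each past. -/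
lemma carrier_law (h : ((μ.prod ν).prod γ).map localMap = (μ.prod ν).prod γ) (m : ℤ) (k : ℕ) :
    ((siteLaw μ ν).prod γ).map (fun p => carrier p.1 m p.2 k) = γ := by
  have hle : ∀ k : ℕ, @Prod.instMeasurableSpace (ℤ → ℝ × ℝ) ℝ (past (m + k)) _ ≤
      Prod.instMeasurableSpace := fun k =>
    sup_le_sup (MeasurableSpace.comap_mono (past_le _)) le_rfl
  have hm : ∀ k, Measurable fun p : (ℤ → ℝ × ℝ) × ℝ => carrier p.1 m p.2 k := fun k =>
    (measurable_carrier m k).mono (hle k) le_rfl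
  ext B hB
  rw [Measure.map_apply (hm k) hB]
  have hY : ∀ i : ℕ, ∀ n : ℕ, i < n →
      Measurable[@Prod.instMeasurableSpace _ ℝ (past (m + n)) _] fun p : (ℤ → ℝ × ℝ) × ℝ =>
        (localMap (drive p.1 (m + i), carrier p.1 m p.2 i)).1 := by
    intro i n hin
    have h1 : Measurable[past (m + n)] fun x : ℤ → ℝ × ℝ => drive x (m + i) :=
      measurable_drive_past (by omega)
    have h2 := (measurable_carrier m i).mono (sup_le_sup (MeasurableSpace.comap_mono
      (past_mono (n := m + n) (by omega))) le_rfl) le_rfl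
    let _ : MeasurableSpace (ℤ → ℝ × ℝ) := past (m + n)
    exact measurable_fst.comp (measurable_localMap.comp ((h1.comp measurable_fst).prodMk h2))
  have hb := burke (P := (siteLaw μ ν).prod γ) measurable_localMap h
    (ξ := fun k p => drive p.1 (m + k))
    (Y := fun k p => (localMap (drive p.1 (m + k), carrier p.1 m p.2 k)).1)
    (U := fun k p => carrier p.1 m p.2 k)
    (𝓕 := fun k => @Prod.instMeasurableSpace _ ℝ (past (m + k)) _) hle
    (fun k => by fun_prop) (fun k => ?_) (fun k => ?_) (fun k => measurable_carrier m k)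
    (fun n i hin => hY i n hin) (fun k => ae_of_all _ fun p => rfl) ?_
    (A := fun _ => Set.univ) (fun _ => MeasurableSet.univ) k hB
  · simpa using hb
  · have : (fun p : (ℤ → ℝ × ℝ) × ℝ => drive p.1 (m + k)) =
        (fun x => drive x (m + k)) ∘ Prod.fst := rfl
    rw [this, ← Measure.map_map (by fun_prop) (by fun_prop), Measure.map_fst_prod, measure_univ,
      one_smul, siteLaw_map_drive_eval]
  · have := indep_comap_fst_prod (γ := γ) (Measurable.comap_le (by fun_prop)) (past_le (m + k))
      (indep_drive_past (μ := μ) (ν := ν) (m + k))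
    rw [MeasurableSpace.comap_comp] at this
    exact this
  · simp [carrier]

/-- The reciprocal of a carrier started k sites to the left dominates the first k terms, and its law
does not depend on k. So the probability that the series exceeds M is at most a tail of `γ`. -/
lemma ae_vmin_ne_top (h : ((μ.prod ν).prod γ).map localMap = (μ.prod ν).prod γ)
    (hpos : ∀ᵐ x ∂siteLaw μ ν, Pos x) (hγ : ∀ᵐ u ∂γ, 0 < u) (n : ℤ) :
    ∀ᵐ x ∂siteLaw μ ν, vmin x n ≠ ∞ := by
  have hbound : ∀ M : ℕ, siteLaw μ ν {x | vmin x n = ∞} ≤ γ {u | (M : ℝ) < u⁻¹} := by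
    intro M
    let S : ℕ → Set (ℤ → ℝ × ℝ) := fun k =>
      {x | (M : ℝ≥0∞) < ∑ i ∈ Finset.range k, ENNReal.ofReal (term x n i)}
    have hS : Monotone S := by
      intro a b hab x hx
      have hx : (M : ℝ≥0∞) < ∑ i ∈ Finset.range a, ENNReal.ofReal (term x n i) := hx
      exact lt_of_lt_of_le hx (Finset.sum_le_sum_of_subset (Finset.range_mono hab))
    have hsub : {x | vmin x n = ∞} ⊆ ⋃ k, S k := by
      intro x hx
      have hx : vmin x n = ∞ := hx
      rw [vmin, ENNReal.tsum_eq_iSup_nat] at hx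
      have : (M : ℝ≥0∞) < ⨆ k, ∑ i ∈ Finset.range k, ENNReal.ofReal (term x n i) := by
        rw [hx]; exact ENNReal.natCast_lt_top M
      obtain ⟨k, hk⟩ := lt_iSup_iff.1 this
      exact Set.mem_iUnion.2 ⟨k, hk⟩
    refine (measure_mono hsub).trans ?_
    rw [hS.measure_iUnion]
    refine iSup_le fun k => ?_
    have hSm : MeasurableSet (S k) := measurableSet_lt measurable_const (by fun_prop)
    have hm : Measurable fun p : (ℤ → ℝ × ℝ) × ℝ => carrier p.1 (n - k) p.2 k :=
      (measurable_carrier _ k).mono (sup_le_sup (MeasurableSpace.comap_mono (past_le _)) le_rfl)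
        le_rfl
    have hT : MeasurableSet {u : ℝ | (M : ℝ) < u⁻¹} := measurableSet_lt measurable_const
      measurable_inv
    have e1 : siteLaw μ ν (S k) = ((siteLaw μ ν).prod γ) (Prod.fst ⁻¹' S k) := by
      rw [← Measure.map_apply measurable_fst hSm, Measure.map_fst_prod, measure_univ, one_smul]
    have e2 := congrArg (fun m => m {u : ℝ | (M : ℝ) < u⁻¹}) (carrier_law h (n - k) k)
    rw [Measure.map_apply hm hT] at e2
    rw [e1, ← e2]
    refine measure_mono_ae ?_
    filter_upwards [Measure.quasiMeasurePreserving_fst.ae hpos,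
      Measure.quasiMeasurePreserving_snd.ae hγ] with p h1 h2 h3
    have h3 : (M : ℝ≥0∞) < ∑ i ∈ Finset.range k, ENNReal.ofReal (term p.1 n i) := h3
    change (M : ℝ) < (carrier p.1 (n - k) p.2 k)⁻¹
    rw [inv_carrier h1 _ h2, sub_add_cancel]
    rw [← ENNReal.ofReal_sum_of_nonneg fun i _ => (term_pos h1 n i).le,
      ← ENNReal.ofReal_natCast, ENNReal.ofReal_lt_ofReal_iff_of_nonneg (Nat.cast_nonneg _)] at h3
    have := mul_pos (ratioProd_pos h1 n k) (inv_pos.2 h2)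
    linarith
  have htail : Tendsto (fun M : ℕ => γ {u : ℝ | (M : ℝ) < u⁻¹}) atTop (𝓝 0) := by
    have h : ⋂ M : ℕ, {u : ℝ | (M : ℝ) < u⁻¹} = ∅ := by
      refine Set.eq_empty_of_forall_notMem fun u hu => ?_
      obtain ⟨M, hM⟩ := exists_nat_ge u⁻¹
      exact absurd (show (M : ℝ) < u⁻¹ from Set.mem_iInter.1 hu M) (not_lt.2 hM)
    rw [← measure_empty (μ := γ), ← h]
    refine tendsto_measure_iInter_atTop (fun M => (measurableSet_lt measurable_const
      measurable_inv).nullMeasurableSet) ?_ ⟨0, measure_ne_top _ _⟩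
    intro a b hab u hu
    exact lt_of_le_of_lt (Nat.cast_le.2 hab) (show (b : ℝ) < u⁻¹ from hu)
  have h0 : siteLaw μ ν {x | vmin x n = ∞} = 0 :=
    le_antisymm (ge_of_tendsto' htail hbound) zero_le
  rw [ae_iff]
  simpa using h0

/-- Along a subsequence of starting sites the remainder in `inv_carrier` vanishes, so carriers of
constant law `γ` converge almost surely to `umin`. -/
lemma umin_law (h : ((μ.prod ν).prod γ).map localMap = (μ.prod ν).prod γ)
    (hpos : ∀ᵐ x ∂siteLaw μ ν, Pos x) (hγ : ∀ᵐ u ∂γ, 0 < u) (n : ℤ) :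
    (siteLaw μ ν).map (fun x => umin x n) = γ := by
  have hfin := ae_vmin_ne_top h hpos hγ n
  obtain ⟨ns, hns, hlim⟩ := (tendstoInMeasure_ratioProd hpos n hfin).exists_seq_tendsto_ae
  have := Measure.isProbabilityMeasure_map (μ := siteLaw μ ν)
    (measurable_umin n).aemeasurable
  have hm : ∀ k : ℕ, Measurable fun p : (ℤ → ℝ × ℝ) × ℝ => carrier p.1 (n - k) p.2 k := fun k =>
      (measurable_carrier _ k).mono (sup_le_sup (MeasurableSpace.comap_mono (past_le _)) le_rfl)
        le_rfl
  refine ext_of_forall_integral_eq_of_IsFiniteMeasure fun f => ?_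
  have hconst : ∀ k : ℕ, ∫ p, f (carrier p.1 (n - k) p.2 k) ∂((siteLaw μ ν).prod γ) =
      ∫ u, f u ∂γ := by
    intro k
    have e := integral_map (μ := (siteLaw μ ν).prod γ) (hm k).aemeasurable
      (f := f) f.continuous.aestronglyMeasurable
    rw [carrier_law h] at e
    exact e.symm
  have hconv : Tendsto (fun i => ∫ p, f (carrier p.1 (n - ns i) p.2 (ns i))
      ∂((siteLaw μ ν).prod γ)) atTop (𝓝 (∫ p, f (umin p.1 n) ∂((siteLaw μ ν).prod γ))) := by
    refine tendsto_integral_of_dominated_convergence (fun _ => ‖f‖)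
      (fun i => (f.continuous.measurable.comp (hm _)).aestronglyMeasurable)
      (integrable_const _) (fun i => ae_of_all _ fun p => f.norm_coe_le_norm _) ?_
    filter_upwards [Measure.quasiMeasurePreserving_fst.ae hpos,
      Measure.quasiMeasurePreserving_fst.ae hfin, Measure.quasiMeasurePreserving_fst.ae hlim,
      Measure.quasiMeasurePreserving_snd.ae hγ] with p h1 h2 h3 h4
    refine (f.continuous.tendsto _).comp ?_
    have hsum : Tendsto (fun k => ∑ i ∈ Finset.range k, term p.1 n i) atTop
        (𝓝 (vmin p.1 n).toReal) := by
      have h5 := (ENNReal.summable (f := fun k =>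
        ENNReal.ofReal (term p.1 n k))).hasSum.tendsto_sum_nat
      have h6 := (ENNReal.tendsto_toReal h2).comp h5
      refine h6.congr fun k => ?_
      rw [Function.comp_apply, ← ENNReal.ofReal_sum_of_nonneg fun i _ => (term_pos h1 n i).le,
        ENNReal.toReal_ofReal (Finset.sum_nonneg fun i _ => (term_pos h1 n i).le)]
    have h5 := ((hsum.comp hns.tendsto_atTop).add (h3.mul_const p.2⁻¹)).inv₀
      (by rw [zero_mul, add_zero]; exact (vmin_toReal_pos h1 h2).ne')
    rw [zero_mul, add_zero] at h5
    refine h5.congr fun i => ?_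
    have e := inv_carrier h1 (n - ns i) h4 (ns i)
    rw [sub_add_cancel] at e
    simp only [Function.comp_apply]
    rw [← e, inv_inv]
  simp only [hconst] at hconv
  rw [← tendsto_nhds_unique hconv tendsto_const_nhds,
    integral_map (measurable_umin n).aemeasurable f.continuous.aestronglyMeasurable]
  have := integral_map (μ := (siteLaw μ ν).prod γ) (φ := Prod.fst) measurable_fst.aemeasurable
    (f := fun x => f (umin x n))
    (f.continuous.measurable.comp (measurable_umin n)).aestronglyMeasurable
  rw [Measure.map_fst_prod, measure_univ, one_smul] at this
  exact this

lemma siteLaw_map_evolve (h : ((μ.prod ν).prod γ).map localMap = (μ.prod ν).prod γ)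
    (hpos : ∀ᵐ x ∂siteLaw μ ν, Pos x) (hγ : ∀ᵐ u ∂γ, 0 < u) :
    (siteLaw μ ν).map evolve = siteLaw μ ν := by
  have hfin := ae_all_iff.2 (ae_vmin_ne_top h hpos hγ)
  have hblock : ∀ (m : ℤ) (k : ℕ) (A : ℕ → Set (ℝ × ℝ)), (∀ i, MeasurableSet (A i)) →
      siteLaw μ ν (⋂ i ∈ Finset.range k, (fun x => evolve x (m + i)) ⁻¹' A i) =
        ∏ i ∈ Finset.range k, (μ.prod ν) (A i) := by
    intro m k A hA
    have hb := burke (P := siteLaw μ ν) measurable_localMap h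
      (ξ := fun k x => drive x (m + k)) (Y := fun k x => evolve x (m + k))
      (U := fun k x => umin x (m + k)) (𝓕 := fun k => past (m + k)) (fun k => past_le _)
      (fun k => by fun_prop) (fun k => siteLaw_map_drive_eval _) (fun k => indep_drive_past _)
      (fun k => measurable_umin_past _) (fun k i hik => measurable_evolve_past (by omega))
      (fun k => ?_) ?_ hA k MeasurableSet.univ
    · simpa using hb
    · filter_upwards [hpos, hfin] with x h1 h2
      have := umin_succ h1 h2 (m + k)
      simp only [localMap, drive, evolve]
      push_cast
      rw [← add_assoc, this]
    · simpa using umin_law h hpos hγ m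
  refine Measure.eq_infinitePi _ fun s t ht => ?_
  -- `burke` handles blocks of consecutive sites. The finite set `s` is enclosed in the window [-N,
  -- N) and the other sites are left unconstrained.
  let N := s.sup Int.natAbs + 1
  let A : ℕ → Set (ℝ × ℝ) := fun i => if (-N + i : ℤ) ∈ s then t (-N + i) else Set.univ
  have hs : ∀ j ∈ s, -(N : ℤ) ≤ j ∧ j < N := by
    intro j hj
    have := Finset.le_sup (f := Int.natAbs) hj
    omega
  have hA : ∀ i, MeasurableSet (A i) := by
    intro i
    simp only [A]
    split_ifs
    · exact ht _
    · exact MeasurableSet.univ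
  have hb := hblock (-N) (2 * N) A hA
  have hset : evolve ⁻¹' (s : Set ℤ).pi t =
      ⋂ i ∈ Finset.range (2 * N), (fun x => evolve x (-N + i)) ⁻¹' A i := by
    ext x
    simp only [Set.mem_preimage, Set.mem_pi, Finset.mem_coe, Set.mem_iInter, A]
    constructor
    · intro hx i _
      split_ifs with hi
      · exact hx _ hi
      · trivial
    · intro hx j hj
      have hj' := hs j hj
      have := hx (j + N).toNat (by rw [Finset.mem_range]; omega)
      rw [show (-N + ((j + N).toNat : ℤ) : ℤ) = j by omega, if_pos hj] at this
      exact this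
  rw [Measure.map_apply measurable_evolve (.pi s.countable_toSet fun _ _ => ht _), hset, hb]
  let f : ℤ → ℝ≥0∞ := fun j => if j ∈ s then (μ.prod ν) (t j) else 1
  have hf : ∀ i ∈ Finset.range (2 * N), (μ.prod ν) (A i) = f (-N + i) := by
    intro i _
    simp only [A, f]
    split_ifs
    · rfl
    · exact measure_univ
  rw [Finset.prod_congr rfl hf,
    ← Finset.prod_image (s := Finset.range (2 * N)) (f := f) (g := fun i : ℕ => (-N + i : ℤ))
      (by intro a _ b _ hab; simpa using hab)]
  rw [← Finset.prod_subset (s₁ := s)]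
  · exact Finset.prod_congr rfl fun j hj => if_pos hj
  · intro j hj
    have := hs j hj
    exact Finset.mem_image.2 ⟨(j + N).toNat, by rw [Finset.mem_range]; omega, by omega⟩
  · intro j _ hj
    exact if_neg hj

/-- Invariance carries almost sure regularity along all forward iterates, and reflection invariance
carries it to the backward half. -/
theorem ae_evolution (h : ((μ.prod ν).prod γ).map localMap = (μ.prod ν).prod γ)
    (hμ : ∀ᵐ a ∂μ, 0 < a) (hν : ∀ᵐ a ∂ν, 0 < a) (hγ : ∀ᵐ u ∂γ, 0 < u) :
    ∀ᵐ x ∂siteLaw μ ν, x ∈ todaDomain ∧ todaStep x = evolve x := by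
  have hpos := ae_pos hμ hν
  have hreg : ∀ᵐ x ∂siteLaw μ ν, Regular x :=
    ae_regular hpos (ae_all_iff.2 (ae_vmin_ne_top h hpos hγ))
  have hT : MeasurePreserving evolve (siteLaw μ ν) (siteLaw μ ν) :=
    ⟨measurable_evolve, siteLaw_map_evolve h hpos hγ⟩
  have hR : MeasurePreserving reflect (siteLaw μ ν) (siteLaw μ ν) :=
    ⟨measurable_reflect, siteLaw_map_reflect⟩
  have h1 : ∀ᵐ x ∂siteLaw μ ν, ∀ k, Regular (evolve^[k] x) :=
    ae_all_iff.2 fun k => (hT.iterate k).quasiMeasurePreserving.ae hreg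
  have h2 := hR.quasiMeasurePreserving.ae h1
  filter_upwards [h1, h2] with x hx1 hx2
  have hx := mem_todaDomain_of_regular hx1 hx2
  exact ⟨hx, todaStep_eq_evolve hx (hx1 0).ratioProd_small⟩

end Stationary

/-! ### Sum and ratio of gamma variables; invariance of the local map -/

section GammaBeta

/-- The density of the beta distribution on `[0, 1]`. -/
noncomputable def betaDensity (a b r : ℝ) : ℝ≥0∞ :=
  ENNReal.ofReal (if 0 ≤ r ∧ r ≤ 1 then
    Real.Gamma (a + b) / (Real.Gamma a * Real.Gamma b) * (r ^ (a - 1) * (1 - r) ^ (b - 1)) else 0)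

@[fun_prop]
lemma measurable_betaDensity (a b : ℝ) : Measurable (betaDensity a b) := by
  unfold betaDensity
  refine Measurable.ennreal_ofReal (Measurable.ite ?_ (by fun_prop) measurable_const)
  exact (measurableSet_le measurable_const measurable_id).inter
    (measurableSet_le measurable_id measurable_const)

@[fun_prop]
lemma measurable_gammaPDF (a c : ℝ) : Measurable (gammaPDF a c) :=
  (measurable_gammaPDFReal a c).ennreal_ofReal

/-- The density identity in the coordinates s = x + y, r = x/s; the leading factor s is the
Jacobian. -/
lemma gammaPDF_mul_gammaPDF {a b c s : ℝ} (ha : 0 < a) (hb : 0 < b) (hc : 0 < c) (hs : 0 < s)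
    (r : ℝ) : ENNReal.ofReal s * (gammaPDF a c (s * r) * gammaPDF b c (s - s * r)) =
      gammaPDF (a + b) c s * betaDensity a b r := by
  have e : s - s * r = s * (1 - r) := by ring
  rw [e]
  by_cases h : 0 ≤ r ∧ r ≤ 1
  · have h1 : 0 ≤ 1 - r := by linarith [h.2]
    have hr := h.1
    rw [gammaPDF_of_nonneg (by positivity), gammaPDF_of_nonneg (by positivity),
      gammaPDF_of_nonneg hs.le, betaDensity, if_pos h]
    have g1 := Real.Gamma_pos_of_pos ha
    have g2 := Real.Gamma_pos_of_pos hb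
    have g3 := Real.Gamma_pos_of_pos (add_pos ha hb)
    rw [← ENNReal.ofReal_mul (by positivity), ← ENNReal.ofReal_mul (by positivity),
      ← ENNReal.ofReal_mul (by positivity)]
    congr 1
    rw [Real.mul_rpow hs.le hr, Real.mul_rpow hs.le h1, Real.rpow_add hc,
      show a + b - 1 = 1 + (a - 1) + (b - 1) by ring, Real.rpow_add hs, Real.rpow_add hs,
      Real.rpow_one, show -(c * s) = -(c * (s * r)) + -(c * (s * (1 - r))) by ring, Real.exp_add]
    field_simp
  · rw [betaDensity, if_neg h, ENNReal.ofReal_zero, mul_zero]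
    rcases not_and_or.1 h with h | h
    · rw [gammaPDF_of_neg (mul_neg_of_pos_of_neg hs (not_le.1 h)), zero_mul, mul_zero]
    · rw [gammaPDF_of_neg (x := s * (1 - r))
        (mul_neg_of_pos_of_neg hs (by linarith [not_le.1 h])), mul_zero, mul_zero]

lemma lintegral_comp_mul {s : ℝ} (hs : 0 < s) {g : ℝ → ℝ≥0∞} (hg : Measurable g) :
    ∫⁻ x, g x = ENNReal.ofReal s * ∫⁻ r, g (s * r) := by
  conv_lhs => rw [← Real.smul_map_volume_mul_left hs.ne']
  rw [lintegral_smul_measure, lintegral_map hg (by fun_prop), abs_of_pos hs, smul_eq_mul]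

/-- The sum of two independent gamma variables is independent of their ratio. -/
lemma exists_map_sum_ratio {a b c : ℝ} (ha : 0 < a) (hb : 0 < b) (hc : 0 < c) :
    ∃ β : Measure ℝ, IsProbabilityMeasure β ∧
      ((gammaMeasure a c).prod (gammaMeasure b c)).map (fun p => (p.1 + p.2, p.1 / (p.1 + p.2))) =
        (gammaMeasure (a + b) c).prod β := by
  have := isProbabilityMeasure_gammaMeasure ha hc
  have := isProbabilityMeasure_gammaMeasure hb hc
  have := isProbabilityMeasure_gammaMeasure (add_pos ha hb) hc
  set β := volume.withDensity (betaDensity a b)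
  have hβ : SFinite β := inferInstance
  have key : ((gammaMeasure a c).prod (gammaMeasure b c)).map
      (fun p => (p.1 + p.2, p.1 / (p.1 + p.2))) = (gammaMeasure (a + b) c).prod β := by
    refine Measure.ext_of_lintegral _ fun f hf => ?_
    rw [lintegral_map hf (by fun_prop), lintegral_prod _ (by fun_prop),
      lintegral_prod _ (by fun_prop)]
    have h1 : ∀ x, ∫⁻ y, f (x + y, x / (x + y)) ∂gammaMeasure b c =
        ∫⁻ s, gammaPDF b c (s - x) * f (s, x / s) := by
      intro x
      rw [gammaMeasure, lintegral_withDensity_eq_lintegral_mul _ (by fun_prop) (by fun_prop),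
        ← lintegral_sub_right_eq_self _ x]
      simp
    have h2 : ∀ s, ∫⁻ r, f (s, r) ∂β = ∫⁻ r, betaDensity a b r * f (s, r) := by
      intro s
      rw [lintegral_withDensity_eq_lintegral_mul _ (by fun_prop) (by fun_prop)]
      rfl
    simp only [h1, h2]
    rw [gammaMeasure, lintegral_withDensity_eq_lintegral_mul _ (by fun_prop) (by fun_prop),
      gammaMeasure, lintegral_withDensity_eq_lintegral_mul _ (by fun_prop) (by fun_prop)]
    simp only [Pi.mul_apply]
    have h3 : ∀ x, gammaPDF a c x * ∫⁻ s, gammaPDF b c (s - x) * f (s, x / s) =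
        ∫⁻ s, gammaPDF a c x * (gammaPDF b c (s - x) * f (s, x / s)) := fun x =>
      (lintegral_const_mul _ (by fun_prop)).symm
    simp only [h3]
    rw [lintegral_lintegral_swap (by fun_prop)]
    refine lintegral_congr_ae ?_
    filter_upwards [(Set.countable_singleton (0 : ℝ)).ae_notMem volume] with s hs
    rcases lt_trichotomy s 0 with h | h | h
    · rw [gammaPDF_of_neg h, zero_mul]
      rw [← lintegral_zero]
      refine lintegral_congr fun x => ?_
      rcases lt_or_ge x 0 with hx | hx
      · rw [gammaPDF_of_neg hx, zero_mul]
      · rw [gammaPDF_of_neg (x := s - x) (by linarith), zero_mul, mul_zero]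
    · exact absurd h hs
    · rw [lintegral_comp_mul h (by fun_prop), ← lintegral_const_mul _ (by fun_prop),
        ← lintegral_const_mul _ (by fun_prop)]
      refine lintegral_congr fun r => ?_
      rw [mul_div_cancel_left₀ _ h.ne', ← mul_assoc, ← mul_assoc, ← mul_assoc,
        mul_assoc (ENNReal.ofReal s), gammaPDF_mul_gammaPDF ha hb hc h]
  -- The total mass of `β` is read off from `key`, so no beta integral is evaluated.
  refine ⟨β, ⟨?_⟩, key⟩
  have h := congrArg (fun m => m Set.univ) key
  simp only [← Set.univ_prod_univ, Measure.prod_prod] at h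
  rw [Set.univ_prod_univ, Measure.map_apply (by fun_prop) MeasurableSet.univ, Set.preimage_univ,
    measure_univ, measure_univ, one_mul] at h
  exact h.symm

lemma gammaMeasure_ae_pos (a c : ℝ) : ∀ᵐ x ∂gammaMeasure a c, 0 < x := by
  rw [gammaMeasure, ae_withDensity_iff (by fun_prop)]
  filter_upwards [(Set.countable_singleton (0 : ℝ)).ae_notMem volume] with x hx h
  rcases lt_trichotomy x 0 with h1 | h1 | h1
  · exact absurd (gammaPDF_of_neg h1) h
  · exact absurd h1 hx
  · exact h1

/-- The local map preserves products of suitable gamma laws. -/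
lemma localMap_gamma {a b c : ℝ} (ha : 0 < a) (hb : 0 < b) (hc : 0 < c) :
    (((gammaMeasure (a + b) c).prod (gammaMeasure a c)).prod (gammaMeasure b c)).map localMap =
      ((gammaMeasure (a + b) c).prod (gammaMeasure a c)).prod (gammaMeasure b c) := by
  have := isProbabilityMeasure_gammaMeasure ha hc
  have := isProbabilityMeasure_gammaMeasure hb hc
  have := isProbabilityMeasure_gammaMeasure (add_pos ha hb) hc
  obtain ⟨β, hβ, key⟩ := exists_map_sum_ratio ha hb hc
  set G := gammaMeasure (a + b) c
  set A := gammaMeasure a c with hA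
  set B := gammaMeasure b c with hB
  let Φ : ℝ × ℝ → ℝ × ℝ := fun p => (p.1 + p.2, p.1 / (p.1 + p.2))
  let Ψ : ℝ × ℝ → ℝ × ℝ := fun p => (p.1 * p.2, p.1 * (1 - p.2))
  have hΦm : Measurable Φ := by fun_prop
  have hΨm : Measurable Ψ := by fun_prop
  have hΦ : MeasurePreserving Φ (A.prod B) (G.prod β) := ⟨hΦm, key⟩
  have hposAB : ∀ᵐ p ∂A.prod B, 0 < p.1 ∧ 0 < p.2 := by
    filter_upwards [Measure.quasiMeasurePreserving_fst.ae (gammaMeasure_ae_pos a c),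
      Measure.quasiMeasurePreserving_snd.ae (gammaMeasure_ae_pos b c)] with p h1 h2
    exact ⟨h1, h2⟩
  have hΨ : MeasurePreserving Ψ (G.prod β) (A.prod B) := by
    refine ⟨hΨm, ?_⟩
    rw [← hΦ.map_eq, Measure.map_map hΨm hΦm]
    conv_rhs => rw [← Measure.map_id (μ := A.prod B)]
    refine Measure.map_congr ?_
    filter_upwards [hposAB] with p hp
    have h1 := hp.1
    have h2 := hp.2
    ext
    · simp only [Ψ, Φ, Function.comp_apply, id]; field_simp
    · simp only [Ψ, Φ, Function.comp_apply, id]; field_simp; ring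
  -- With S, R the sum and ratio of (J, U), the local map is (I, S, R) ↦ (S, I·R, I·(1-R)). I and S
  -- have the same law, so it amounts to exchanging them and undoing the sum-ratio map.
  have m1 := measurePreserving_prodAssoc G A B
  have m2 := (MeasurePreserving.id G).prod hΦ
  have m3 := (measurePreserving_prodAssoc G G β).symm
  have m4 := (Measure.measurePreserving_swap (μ := G) (ν := G)).prod (MeasurePreserving.id β)
  have m5 := measurePreserving_prodAssoc G G β
  have m6 := (MeasurePreserving.id G).prod hΨ
  have m7 := (measurePreserving_prodAssoc G A B).symm
  have hall := m7.comp (m6.comp (m5.comp (m4.comp (m3.comp (m2.comp m1)))))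
  conv_rhs => rw [← hall.map_eq]
  refine Measure.map_congr ?_
  have h1 := m1.quasiMeasurePreserving.ae (Measure.quasiMeasurePreserving_snd.ae hposAB)
  filter_upwards [h1] with p hp
  obtain ⟨⟨i, j⟩, u⟩ := p
  simp only [MeasurableEquiv.prodAssoc, MeasurableEquiv.coe_mk, Equiv.prodAssoc_apply] at hp
  have hj := hp.1
  have hu := hp.2
  simp only [Function.comp_apply, MeasurableEquiv.prodAssoc, MeasurableEquiv.coe_mk,
    Equiv.prodAssoc_apply, Prod.map, Φ, Ψ, localMap, Prod.swap, id, MeasurableEquiv.symm_mk,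
    Equiv.prodAssoc_symm_apply]
  refine Prod.ext (Prod.ext rfl ?_) ?_
  · simp only; field_simp
  · simp only; field_simp; ring

end GammaBeta

/-! ### Laplace transforms determine laws on the positive half-line -/

section Laplace

/-- Laws on `[0, 1]` are determined by their moments. -/
lemma ext_of_moments {μ ν : Measure ℝ} [IsProbabilityMeasure μ] [IsProbabilityMeasure ν]
    (hμ : ∀ᵐ x ∂μ, x ∈ Set.Icc (0 : ℝ) 1) (hν : ∀ᵐ x ∂ν, x ∈ Set.Icc (0 : ℝ) 1)
    (h : ∀ n : ℕ, ∫ x, x ^ n ∂μ = ∫ x, x ^ n ∂ν) : μ = ν := by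
  refine ext_of_forall_integral_eq_of_IsFiniteMeasure fun f => ?_
  have hint : ∀ (m : Measure ℝ) [IsProbabilityMeasure m], (∀ᵐ x ∂m, x ∈ Set.Icc (0 : ℝ) 1) →
      ∀ n : ℕ, Integrable (fun x : ℝ => x ^ n) m := by
    intro m _ hm n
    refine Integrable.of_bound (by fun_prop) 1 ?_
    filter_upwards [hm] with x hx
    rw [Real.norm_of_nonneg (pow_nonneg hx.1 n)]
    exact pow_le_one₀ hx.1 hx.2
  have hpoly : ∀ (m : Measure ℝ) [IsProbabilityMeasure m], (∀ᵐ x ∂m, x ∈ Set.Icc (0 : ℝ) 1) →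
      ∀ p : Polynomial ℝ, Integrable (fun x => p.eval x) m ∧
        ∫ x, p.eval x ∂m = ∑ i ∈ Finset.range (p.natDegree + 1), p.coeff i * ∫ x, x ^ i ∂m := by
    intro m _ hm p
    simp only [Polynomial.eval_eq_sum_range]
    refine ⟨integrable_finsetSum _ fun i _ => (hint m hm i).const_mul _, ?_⟩
    rw [integral_finsetSum _ fun i _ => (hint m hm i).const_mul _]
    simp only [integral_const_mul]
  have hclose : ∀ (m : Measure ℝ) [IsProbabilityMeasure m], (∀ᵐ x ∂m, x ∈ Set.Icc (0 : ℝ) 1) →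
      ∀ (p : Polynomial ℝ) (ε : ℝ), (∀ x ∈ Set.Icc (0 : ℝ) 1, |p.eval x - f x| < ε) →
        |∫ x, p.eval x ∂m - ∫ x, f x ∂m| ≤ ε := by
    intro m _ hm p ε hp
    rw [← integral_sub (hpoly m hm p).1 (f.integrable m)]
    have := norm_integral_le_of_norm_le_const (μ := m) (f := fun x => p.eval x - f x) (C := ε)
      (hm.mono fun x hx => (hp x hx).le)
    simpa using this
  refine eq_of_forall_dist_le fun ε hε => ?_
  obtain ⟨p, hp⟩ := exists_polynomial_near_of_continuousOn 0 1 f f.continuous.continuousOn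
    (ε / 2) (half_pos hε)
  have h1 := hclose μ hμ p _ hp
  have h2 := hclose ν hν p _ hp
  rw [(hpoly μ hμ p).2] at h1
  rw [(hpoly ν hν p).2] at h2
  simp only [h] at h1
  rw [Real.dist_eq]
  rw [abs_le] at h1 h2 ⊢
  constructor <;> linarith [h1.1, h1.2, h2.1, h2.2]

/-- Laws on `(0, ∞)` are determined by their Laplace transform. -/
lemma ext_of_laplace {μ ν : Measure ℝ} [IsProbabilityMeasure μ] [IsProbabilityMeasure ν]
    (hμ : ∀ᵐ x ∂μ, 0 < x) (hν : ∀ᵐ x ∂ν, 0 < x)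
    (h : ∀ t < 0, ∫ x, Real.exp (t * x) ∂μ = ∫ x, Real.exp (t * x) ∂ν) : μ = ν := by
  have he : Measurable fun x : ℝ => Real.exp (-x) := by fun_prop
  have hl : Measurable fun x : ℝ => -Real.log x := by fun_prop
  have hback : ∀ m : Measure ℝ, (m.map fun x => Real.exp (-x)).map (fun x => -Real.log x) = m := by
    intro m
    rw [Measure.map_map hl he]
    have : (fun x : ℝ => -Real.log x) ∘ (fun x => Real.exp (-x)) = id := by
      funext x; simp
    rw [this, Measure.map_id]
  have hp1 : IsProbabilityMeasure (μ.map fun x => Real.exp (-x)) :=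
    Measure.isProbabilityMeasure_map he.aemeasurable
  have hp2 : IsProbabilityMeasure (ν.map fun x => Real.exp (-x)) :=
    Measure.isProbabilityMeasure_map he.aemeasurable
  have hsupp : ∀ m : Measure ℝ, (∀ᵐ x ∂m, 0 < x) →
      ∀ᵐ x ∂m.map (fun x => Real.exp (-x)), x ∈ Set.Icc (0 : ℝ) 1 := by
    intro m hm
    refine (ae_map_iff (p := fun x => x ∈ Set.Icc (0 : ℝ) 1) he.aemeasurable measurableSet_Icc).2 ?_
    filter_upwards [hm] with x hx
    exact ⟨(Real.exp_pos _).le, Real.exp_le_one_iff.2 (by linarith)⟩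
  -- Under x ↦ exp(-x) the laws move to [0, 1], and the n-th moment there is the Laplace transform
  -- at -n.
  rw [← hback μ, ← hback ν]
  congr 1
  refine ext_of_moments (hsupp μ hμ) (hsupp ν hν) fun n => ?_
  rw [integral_map he.aemeasurable (by fun_prop), integral_map he.aemeasurable (by fun_prop)]
  have e : ∀ x : ℝ, Real.exp (-x) ^ n = Real.exp (-n * x) := by
    intro x
    rw [← Real.exp_nat_mul]
    congr 1
    ring
  simp only [e]
  rcases Nat.eq_zero_or_pos n with rfl | hn
  · simp
  · exact h _ (by simpa using hn)

/-- Exponential tilting only changes the rate from c to c - t; what remains is the ratio of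
normalising constants. -/
lemma integral_exp_gammaMeasure {p c t : ℝ} (hp : 0 < p) (hc : 0 < c) (ht : t < 0) :
    ∫ x, Real.exp (t * x) ∂gammaMeasure p c = (c / (c - t)) ^ p := by
  have hct : 0 < c - t := by linarith
  rw [integral_eq_lintegral_of_nonneg_ae (ae_of_all _ fun x => (Real.exp_pos _).le) (by fun_prop),
    gammaMeasure, lintegral_withDensity_eq_lintegral_mul _ (by fun_prop) (by fun_prop)]
  have e : ∀ x, gammaPDF p c x * ENNReal.ofReal (Real.exp (t * x)) =
      ENNReal.ofReal ((c / (c - t)) ^ p) * gammaPDF p (c - t) x := by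
    intro x
    rcases lt_or_ge x 0 with hx | hx
    · rw [gammaPDF_of_neg hx, gammaPDF_of_neg hx, zero_mul, mul_zero]
    · have g := Real.Gamma_pos_of_pos hp
      rw [gammaPDF_of_nonneg hx, gammaPDF_of_nonneg hx, ← ENNReal.ofReal_mul (by positivity),
        ← ENNReal.ofReal_mul (by positivity)]
      congr 1
      rw [Real.div_rpow hc.le hct.le, show -((c - t) * x) = -(c * x) + t * x by ring, Real.exp_add]
      have := Real.rpow_pos_of_pos hct p
      field_simp
  simp only [Pi.mul_apply, e]
  rw [lintegral_const_mul _ (by fun_prop), lintegral_gammaPDF_eq_one hp hct, mul_one,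
    ENNReal.toReal_ofReal (by positivity)]

end Laplace

/-! ### Moment generating functions of positive variables at negative arguments -/

section MGF

variable {Ω : Type*} {mΩ : MeasurableSpace Ω} {P : Measure Ω} [IsProbabilityMeasure P]

lemma mem_interior_integrableExpSet {Z : Ω → ℝ} (hZ : Measurable Z) (hpos : ∀ᵐ ω ∂P, 0 < Z ω)
    {t : ℝ} (ht : t < 0) : t ∈ interior (integrableExpSet Z P) := by
  refine interior_maximal (s := integrableExpSet Z P) (t := Set.Iio 0) ?_ isOpen_Iio ht
  intro s hs
  refine Integrable.of_bound (by fun_prop) 1 ?_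
  filter_upwards [hpos] with ω hω
  rw [Real.norm_of_nonneg (Real.exp_pos _).le]
  exact Real.exp_le_one_iff.2 (mul_nonpos_of_nonpos_of_nonneg (le_of_lt hs) hω.le)

/-- The boundary condition for the differential equations below; a one-sided limit, since no
exponential moments are assumed. -/
lemma tendsto_mgf_zero {Z : Ω → ℝ} (hZ : Measurable Z) (hpos : ∀ᵐ ω ∂P, 0 < Z ω) :
    Tendsto (mgf Z P) (𝓝[<] 0) (𝓝 1) := by
  have h1 : (1 : ℝ) = ∫ _, (1 : ℝ) ∂P := by simp
  rw [h1]
  refine tendsto_integral_filter_of_dominated_convergence (fun _ => 1)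
    (Eventually.of_forall fun t => by fun_prop) ?_ (integrable_const _) (ae_of_all _ fun ω => ?_)
  · filter_upwards [self_mem_nhdsWithin] with s hs
    filter_upwards [hpos] with ω hω
    rw [Real.norm_of_nonneg (Real.exp_pos _).le]
    exact Real.exp_le_one_iff.2 (mul_nonpos_of_nonpos_of_nonneg (le_of_lt hs) hω.le)
  · have : Continuous fun t : ℝ => Real.exp (t * Z ω) := by fun_prop
    have h := (this.tendsto 0).mono_left (nhdsWithin_le_nhds (s := Set.Iio 0))
    simpa using h

lemma integral_pos_of_ae_pos {f : Ω → ℝ} (hf : Integrable f P) (h : ∀ᵐ ω ∂P, 0 < f ω) :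
    0 < ∫ ω, f ω ∂P := by
  rw [integral_pos_iff_support_of_nonneg_ae (h.mono fun _ h => h.le) hf]
  have : P (Function.support f) = 1 := by
    rw [← prob_compl_eq_zero_iff₀]
    · refine measure_mono_null ?_ (ae_iff.1 h)
      intro ω hω hlt
      exact hω hlt.ne'
    · exact (hf.aestronglyMeasurable.nullMeasurableSet_support)
  rw [this]
  exact one_pos

end MGF

/-! ### The first-order equation for the Laplace transforms -/

section ODE

lemma eqOn_const_of_hasDerivAt {f : ℝ → ℝ} (h : ∀ t < 0, HasDerivAt f 0 t) :
    ∃ C, ∀ t < 0, f t = C :=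
  isOpen_Iio.exists_is_const_of_deriv_eq_zero isPreconnected_Iio
    (fun t ht => (h t ht).differentiableAt.differentiableWithinAt) fun t ht => (h t ht).deriv

/-- A Laplace transform with logarithmic derivative `a / (d - κ t)` is that of a point mass
or of a gamma law. -/
lemma solve_logDeriv {A A1 : ℝ → ℝ} {a d κ : ℝ} (hκ : 0 ≤ κ)
    (hd : ∀ t < 0, 0 < d - κ * t) (hApos : ∀ t < 0, 0 < A t)
    (hA : ∀ t < 0, HasDerivAt A (A1 t) t) (hA0 : Tendsto A (𝓝[<] 0) (𝓝 1))
    (hode : ∀ t < 0, A1 t * (d - κ * t) = a * A t) (ha : 0 < a) :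
    0 < d ∧ ((κ = 0 ∧ ∀ t < 0, A t = Real.exp (t * (a / d))) ∨
      (0 < κ ∧ ∀ t < 0, A t = (d / κ / (d / κ - t)) ^ (a / κ))) := by
  rcases hκ.eq_or_lt with rfl | hκ
  · have hd0 : 0 < d := by simpa using hd (-1) (by norm_num)
    refine ⟨hd0, Or.inl ⟨rfl, ?_⟩⟩
    obtain ⟨C, hC⟩ := eqOn_const_of_hasDerivAt (f := fun t => A t * Real.exp (-(t * (a / d)))) (by
      intro t ht
      have h1 := ((hasDerivAt_id t).mul_const (a / d)).neg.exp
      have h2 := (hA t ht).mul h1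
      convert! h2 using 1
      have h3 := hode t ht
      have h4 : A1 t = a / d * A t := by
        field_simp
        linarith
      rw [h4]
      simp only [Pi.neg_apply, id]
      ring)
    have hlim : Tendsto (fun t => A t * Real.exp (-(t * (a / d)))) (𝓝[<] 0) (𝓝 1) := by
      have hc : Continuous fun t : ℝ => Real.exp (-(t * (a / d))) := by fun_prop
      have h := (hc.tendsto 0).mono_left (nhdsWithin_le_nhds (s := Set.Iio 0))
      simpa using hA0.mul h
    have hC1 : C = 1 := by
      refine tendsto_nhds_unique (tendsto_const_nhds.congr' ?_) hlim
      filter_upwards [self_mem_nhdsWithin] with t ht using (hC t ht).symm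
    intro t ht
    have h := hC t ht
    rw [hC1, Real.exp_neg, mul_inv_eq_one₀ (Real.exp_pos _).ne'] at h
    exact h
  · set p := a / κ with hp
    have hp0 : 0 < p := by positivity
    -- Integrating factor: the logarithmic derivative of (d - κt)^p is -a/(d - κt).
    obtain ⟨C, hC⟩ := eqOn_const_of_hasDerivAt (f := fun t => A t * (d - κ * t) ^ p) (by
      intro t ht
      have hpos := hd t ht
      have h0 : HasDerivAt (fun t => d - κ * t) (-κ) t := by
        simpa using ((hasDerivAt_id t).const_mul κ).const_sub d
      have h2 := (hA t ht).mul (h0.rpow_const (p := p) (Or.inl hpos.ne'))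
      convert! h2 using 1
      have h3 := hode t ht
      have h4 : (d - κ * t) ^ p = (d - κ * t) * (d - κ * t) ^ (p - 1) := by
        rw [Real.rpow_sub_one hpos.ne']
        field_simp
      have h5 : κ * p = a := by rw [hp]; field_simp
      rw [h4, ← mul_assoc, h3, ← h5]
      ring)
    have hlim : Tendsto (fun t => A t * (d - κ * t) ^ p) (𝓝[<] 0) (𝓝 (d ^ p)) := by
      have hc : Continuous fun t : ℝ => (d - κ * t) ^ p :=
        Continuous.rpow_const (by fun_prop) fun _ => Or.inr hp0.le
      have h := (hc.tendsto 0).mono_left (nhdsWithin_le_nhds (s := Set.Iio 0))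
      simpa using hA0.mul h
    have hC1 : C = d ^ p := by
      refine tendsto_nhds_unique (tendsto_const_nhds.congr' ?_) hlim
      filter_upwards [self_mem_nhdsWithin] with t ht using (hC t ht).symm
    have hd0 : 0 ≤ d := by
      have hc : Continuous fun t : ℝ => d - κ * t := by fun_prop
      have h := (hc.tendsto 0).mono_left (nhdsWithin_le_nhds (s := Set.Iio 0))
      simp only [mul_zero, sub_zero] at h
      refine ge_of_tendsto h ?_
      filter_upwards [self_mem_nhdsWithin] with t ht using (hd t ht).le
    -- If d were 0, the constant d^p would vanish, and with it `A`.
    have hdpos : 0 < d := by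
      refine hd0.lt_of_ne fun h => ?_
      have h1 := hC (-1) (by norm_num)
      have h2 := mul_pos (hApos (-1) (by norm_num)) (Real.rpow_pos_of_pos (hd (-1) (by norm_num)) p)
      rw [h1, hC1, ← h, Real.zero_rpow hp0.ne'] at h2
      exact lt_irrefl _ h2
    refine ⟨hdpos, Or.inr ⟨hκ, fun t ht => ?_⟩⟩
    have h1 := hC t ht
    have h2 := hd t ht
    have e : d / κ / (d / κ - t) = d / (d - κ * t) := by
      have : d / κ - t = (d - κ * t) / κ := by field_simp
      rw [this]
      field_simp
    rw [e, Real.div_rpow hdpos.le h2.le, ← hC1, ← h1, mul_div_cancel_right₀]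
    exact (Real.rpow_pos_of_pos h2 p).ne'

end ODE

/-! ### Lukacs' theorem -/

section Lukacs

variable {Ω : Type*} {mΩ : MeasurableSpace Ω} {P : Measure Ω} [IsProbabilityMeasure P]

lemma map_eq_of_mgf_eq {Z : Ω → ℝ} (hZ : Measurable Z) (hpos : ∀ᵐ ω ∂P, 0 < Z ω) {ν : Measure ℝ}
    [IsProbabilityMeasure ν] (hν : ∀ᵐ x ∂ν, 0 < x)
    (h : ∀ t < 0, mgf Z P t = ∫ x, Real.exp (t * x) ∂ν) : P.map Z = ν := by
  have := Measure.isProbabilityMeasure_map (μ := P) hZ.aemeasurable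
  refine ext_of_laplace ((ae_map_iff hZ.aemeasurable measurableSet_Ioi).2 hpos) hν fun t ht => ?_
  rw [integral_map hZ.aemeasurable (by fun_prop), ← h t ht]
  rfl

/-- Lukacs' characterization of the gamma laws. -/
theorem lukacs {X Y : Ω → ℝ} (hX : Measurable X) (hY : Measurable Y) (hXpos : ∀ᵐ ω ∂P, 0 < X ω)
    (hYpos : ∀ᵐ ω ∂P, 0 < Y ω) (hXY : IndepFun X Y P)
    (hSR : IndepFun (fun ω => X ω + Y ω) (fun ω => X ω / (X ω + Y ω)) P) :
    (∃ x y : ℝ, P.map X = Measure.dirac x ∧ P.map Y = Measure.dirac y) ∨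
      ∃ l₁ l₂ c : ℝ, 0 < l₁ ∧ 0 < l₂ ∧ 0 < c ∧
        P.map X = gammaMeasure l₁ c ∧ P.map Y = gammaMeasure l₂ c := by
  set S : Ω → ℝ := fun ω => X ω + Y ω with hSdef
  set R : Ω → ℝ := fun ω => X ω / (X ω + Y ω) with hRdef
  have hS : Measurable S := by fun_prop
  have hR : Measurable R := by fun_prop
  have hSpos : ∀ᵐ ω ∂P, 0 < S ω := by
    filter_upwards [hXpos, hYpos] with ω h1 h2 using add_pos h1 h2
  have hRS : ∀ᵐ ω ∂P, 0 < R ω ∧ R ω < 1 ∧ X ω = R ω * S ω ∧ Y ω = (1 - R ω) * S ω := by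
    filter_upwards [hXpos, hYpos] with ω h1 h2
    simp only [hRdef, hSdef]
    refine ⟨by positivity, ?_, by field_simp, by field_simp; ring⟩
    rw [div_lt_one (by positivity)]
    linarith
  have hbdd : ∀ {f : ℝ → ℝ}, Measurable f → (∀ r, 0 < r → r < 1 → |f r| ≤ 1) →
      Integrable (fun ω => f (R ω)) P := by
    intro f hf h
    refine Integrable.of_bound (hf.comp hR).aestronglyMeasurable 1 ?_
    filter_upwards [hRS] with ω hω using h _ hω.1 hω.2.1
  have iR : Integrable R P := hbdd (f := fun r => r) measurable_id fun r h1 h2 => by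
    rw [abs_of_pos h1]; exact h2.le
  have iR2 : Integrable (fun ω => R ω ^ 2) P := hbdd (f := fun r => r ^ 2) (by fun_prop)
    fun r h1 h2 => by rw [abs_of_pos (by positivity)]; nlinarith
  have iRR : Integrable (fun ω => R ω * (1 - R ω)) P := by
    refine (iR.sub iR2).congr (ae_of_all _ fun ω => ?_)
    simp only [Pi.sub_apply]; ring
  set a := ∫ ω, R ω ∂P with ha_def
  set b := ∫ ω, R ω * (1 - R ω) ∂P with hb_def
  have ha : 0 < a := integral_pos_of_ae_pos iR (hRS.mono fun ω h => h.1)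
  have e1a : ∫ ω, (1 - R ω) ∂P = 1 - a := by
    rw [integral_sub (integrable_const _) iR]; simp [ha_def]
  have ha1 : 0 < 1 - a := by
    rw [← e1a]
    exact integral_pos_of_ae_pos ((integrable_const _).sub iR) (hRS.mono fun ω h => by
      simpa using h.2.1)
  have hb : 0 < b := integral_pos_of_ae_pos iRR (hRS.mono fun ω h =>
    mul_pos h.1 (by linarith [h.2.1]))
  -- The difference a(1-a) - b is the variance of `R`; this is what makes κ nonnegative below.
  have hba : b ≤ a * (1 - a) := by
    have h1 : 0 ≤ ∫ ω, (R ω - a) ^ 2 ∂P := integral_nonneg fun ω => sq_nonneg _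
    have h2 : ∀ ω, (R ω - a) ^ 2 = (1 - 2 * a) * R ω - R ω * (1 - R ω) + a ^ 2 := fun ω => by ring
    simp only [h2] at h1
    have i1 : Integrable (fun ω => (1 - 2 * a) * R ω) P := iR.const_mul _
    have i2 : Integrable (fun ω => (1 - 2 * a) * R ω - R ω * (1 - R ω)) P := i1.sub iRR
    rw [integral_add i2 (integrable_const _), integral_sub i1 iRR, integral_const_mul] at h1
    simp only [integral_const, probReal_univ, smul_eq_mul, one_mul] at h1
    change 0 ≤ (1 - 2 * a) * a - b + a ^ 2 at h1
    nlinarith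
  -- the three Laplace transforms and their derivatives
  set A := mgf X P
  set B := mgf Y P
  set M := mgf S P
  set A1 : ℝ → ℝ := fun t => ∫ ω, X ω * Real.exp (t * X ω) ∂P with hA1
  set B1 : ℝ → ℝ := fun t => ∫ ω, Y ω * Real.exp (t * Y ω) ∂P with hB1
  set M1 : ℝ → ℝ := fun t => ∫ ω, S ω * Real.exp (t * S ω) ∂P with hM1
  set M2 : ℝ → ℝ := fun t => ∫ ω, S ω ^ 2 * Real.exp (t * S ω) ∂P with hM2
  have dA : ∀ t < 0, HasDerivAt A (A1 t) t := fun t ht =>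
    hasDerivAt_mgf (mem_interior_integrableExpSet hX hXpos ht)
  have dB : ∀ t < 0, HasDerivAt B (B1 t) t := fun t ht =>
    hasDerivAt_mgf (mem_interior_integrableExpSet hY hYpos ht)
  have dM : ∀ t < 0, HasDerivAt M (M1 t) t := fun t ht =>
    hasDerivAt_mgf (mem_interior_integrableExpSet hS hSpos ht)
  have dM1 : ∀ t < 0, HasDerivAt M1 (M2 t) t := fun t ht => by
    have := hasDerivAt_integral_pow_mul_exp_real (mem_interior_integrableExpSet hS hSpos ht) 1
    simpa using this
  have pA : ∀ t < 0, 0 < A t := fun t ht =>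
    mgf_pos (integrable_of_mem_integrableExpSet
      (interior_subset (mem_interior_integrableExpSet hX hXpos ht)))
  have pB : ∀ t < 0, 0 < B t := fun t ht =>
    mgf_pos (integrable_of_mem_integrableExpSet
      (interior_subset (mem_interior_integrableExpSet hY hYpos ht)))
  have pM1 : ∀ t < 0, 0 < M1 t := fun t ht => by
    have h := integrable_pow_mul_exp_of_mem_interior_integrableExpSet
      (mem_interior_integrableExpSet hS hSpos ht) 1
    simp only [pow_one] at h
    exact integral_pos_of_ae_pos h (hSpos.mono fun ω h => mul_pos h (Real.exp_pos _))
  have hexp : ∀ t ω, Real.exp (t * S ω) = Real.exp (t * X ω) * Real.exp (t * Y ω) := by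
    intro t ω
    rw [← Real.exp_add]
    congr 1
    simp only [hSdef]
    ring
  have hind : ∀ {f g : ℝ → ℝ}, Measurable f → Measurable g →
      ∫ ω, f (X ω) * g (Y ω) ∂P = (∫ ω, f (X ω) ∂P) * ∫ ω, g (Y ω) ∂P := fun hf hg =>
    (hXY.comp hf hg).integral_fun_mul_eq_mul_integral (hf.comp hX).aestronglyMeasurable
      (hg.comp hY).aestronglyMeasurable
  have hind2 : ∀ {f g : ℝ → ℝ}, Measurable f → Measurable g →
      ∫ ω, f (R ω) * g (S ω) ∂P = (∫ ω, f (R ω) ∂P) * ∫ ω, g (S ω) ∂P := fun hf hg =>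
    (hSR.symm.comp hf hg).integral_fun_mul_eq_mul_integral (hf.comp hR).aestronglyMeasurable
      (hg.comp hS).aestronglyMeasurable
  have eM : ∀ t, M t = A t * B t := by
    intro t
    have h := hind (f := fun x => Real.exp (t * x)) (g := fun y => Real.exp (t * y))
      (by fun_prop) (by fun_prop)
    simp only [← hexp] at h
    exact h
  -- The same expectation factored in two ways: through independence of `X` and `Y`, and, writing X
  -- = R·S, through independence of `R` and `S`. The next two identities use Y = (1-R)·S and X·Y =
  -- R(1-R)·S².
  have eA : ∀ t, A1 t * B t = a * M1 t := by
    intro t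
    have h := hind (f := fun x => x * Real.exp (t * x)) (g := fun y => Real.exp (t * y))
      (by fun_prop) (by fun_prop)
    have h2 := hind2 (f := fun r => r) (g := fun s => s * Real.exp (t * s))
      (by fun_prop) (by fun_prop)
    refine h.symm.trans (Eq.trans (integral_congr_ae ?_) h2)
    filter_upwards [hRS] with ω hω
    rw [mul_assoc, ← hexp, ← mul_assoc, ← hω.2.2.1]
  have eB : ∀ t, B1 t * A t = (1 - a) * M1 t := by
    intro t
    have h := hind (f := fun x => Real.exp (t * x)) (g := fun y => y * Real.exp (t * y))
      (by fun_prop) (by fun_prop)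
    have h2 := hind2 (f := fun r => 1 - r) (g := fun s => s * Real.exp (t * s))
      (by fun_prop) (by fun_prop)
    rw [e1a] at h2
    rw [mul_comm]
    refine h.symm.trans (Eq.trans (integral_congr_ae ?_) h2)
    filter_upwards [hRS] with ω hω
    rw [mul_left_comm, ← hexp, ← mul_assoc, ← hω.2.2.2]
  have eAB : ∀ t, A1 t * B1 t = b * M2 t := by
    intro t
    have h := hind (f := fun x => x * Real.exp (t * x)) (g := fun y => y * Real.exp (t * y))
      (by fun_prop) (by fun_prop)
    have h2 := hind2 (f := fun r => r * (1 - r)) (g := fun s => s ^ 2 * Real.exp (t * s))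
      (by fun_prop) (by fun_prop)
    refine h.symm.trans (Eq.trans (integral_congr_ae ?_) h2)
    filter_upwards [hRS] with ω hω
    rw [mul_mul_mul_comm, ← hexp, hω.2.2.1, hω.2.2.2]
    ring
  -- `M / M1` is affine
  set κ := a * (1 - a) / b - 1 with hκ_def
  have hκ : 0 ≤ κ := by
    rw [hκ_def, sub_nonneg, le_div_iff₀ hb]; linarith
  obtain ⟨d, hd⟩ := eqOn_const_of_hasDerivAt (f := fun t => M t / M1 t + κ * t) (by
    intro t ht
    have h1 := ((dM t ht).div (dM1 t ht) (pM1 t ht).ne').add ((hasDerivAt_id t).const_mul κ)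
    convert! h1 using 1
    have h2 := (pM1 t ht).ne'
    have h3 : b * (M t * M2 t) = a * (1 - a) * M1 t ^ 2 := by
      calc b * (M t * M2 t) = M t * (b * M2 t) := by ring
        _ = (A1 t * B t) * (B1 t * A t) := by rw [← eAB, eM]; ring
        _ = _ := by rw [eA, eB]; ring
    have h4 : M t * M2 t = a * (1 - a) / b * M1 t ^ 2 := by
      field_simp
      linarith
    rw [h4, hκ_def]
    field_simp
    ring)
  have hd' : ∀ t < 0, M t = (d - κ * t) * M1 t := by
    intro t ht
    have h := hd t ht
    have h2 := (pM1 t ht).ne'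
    rw [← h]
    field_simp
    ring
  have pd : ∀ t < 0, 0 < d - κ * t := by
    intro t ht
    have h := hd' t ht
    have hM : 0 < M t := by rw [eM]; exact mul_pos (pA t ht) (pB t ht)
    rw [h] at hM
    exact (pos_iff_pos_of_mul_pos hM).2 (pM1 t ht)
  have odeA : ∀ t < 0, A1 t * (d - κ * t) = a * A t := by
    intro t ht
    have h1 := eA t
    have h2 := hd' t ht
    have h3 := (pB t ht).ne'
    have h4 := (pM1 t ht).ne'
    rw [eM] at h2
    refine mul_right_cancel₀ (mul_ne_zero h3 h4) ?_
    calc A1 t * (d - κ * t) * (B t * M1 t) = (A1 t * B t) * ((d - κ * t) * M1 t) := by ring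
      _ = _ := by rw [h1, ← h2]; ring
  have odeB : ∀ t < 0, B1 t * (d - κ * t) = (1 - a) * B t := by
    intro t ht
    have h1 := eB t
    have h2 := hd' t ht
    have h3 := (pA t ht).ne'
    have h4 := (pM1 t ht).ne'
    rw [eM] at h2
    refine mul_right_cancel₀ (mul_ne_zero h3 h4) ?_
    calc B1 t * (d - κ * t) * (A t * M1 t) = (B1 t * A t) * ((d - κ * t) * M1 t) := by ring
      _ = _ := by rw [h1, ← h2]; ring
  obtain ⟨hdpos, hA⟩ := solve_logDeriv hκ pd pA dA (tendsto_mgf_zero hX hXpos) odeA ha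
  obtain ⟨-, hB⟩ := solve_logDeriv hκ pd pB dB (tendsto_mgf_zero hY hYpos) odeB ha1
  rcases hA with ⟨hκ0, hA⟩ | ⟨hκ0, hA⟩
  · left
    have hB := (hB.resolve_right fun h => h.1.ne' hκ0).2
    refine ⟨a / d, (1 - a) / d, ?_, ?_⟩
    · refine map_eq_of_mgf_eq hX hXpos ?_ fun t ht => ?_
      · rw [ae_dirac_iff measurableSet_Ioi]; positivity
      · rw [integral_dirac]; exact hA t ht
    · refine map_eq_of_mgf_eq hY hYpos ?_ fun t ht => ?_
      · rw [ae_dirac_iff measurableSet_Ioi]; positivity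
      · rw [integral_dirac]; exact hB t ht
  · right
    have hB := (hB.resolve_left fun h => hκ0.ne' h.1).2
    have hl1 : 0 < a / κ := by positivity
    have hl2 : 0 < (1 - a) / κ := by positivity
    have hc : 0 < d / κ := by positivity
    refine ⟨a / κ, (1 - a) / κ, d / κ, hl1, hl2, hc, ?_, ?_⟩
    · have := isProbabilityMeasure_gammaMeasure hl1 hc
      refine map_eq_of_mgf_eq hX hXpos (gammaMeasure_ae_pos _ _) fun t ht => ?_
      rw [integral_exp_gammaMeasure hl1 hc ht]; exact hA t ht
    · have := isProbabilityMeasure_gammaMeasure hl2 hc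
      refine map_eq_of_mgf_eq hY hYpos (gammaMeasure_ae_pos _ _) fun t ht => ?_
      rw [integral_exp_gammaMeasure hl2 hc ht]; exact hB t ht

end Lukacs

/-! ### From invariance to the hypotheses of Lukacs' theorem -/

section Converse

lemma indepFun_prodMk_assoc {Ω α β δ : Type*} {mΩ : MeasurableSpace Ω} [MeasurableSpace α]
    [MeasurableSpace β] [MeasurableSpace δ] {P : Measure Ω} [IsProbabilityMeasure P]
    {f : Ω → α} {g : Ω → β} {h : Ω → δ} (hf : Measurable f) (hg : Measurable g)
    (hh : Measurable h) (h1 : IndepFun f g P) (h2 : IndepFun (fun ω => (f ω, g ω)) h P) :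
    IndepFun f (fun ω => (g ω, h ω)) P := by
  have := Measure.isProbabilityMeasure_map (μ := P) hf.aemeasurable
  have := Measure.isProbabilityMeasure_map (μ := P) hg.aemeasurable
  have := Measure.isProbabilityMeasure_map (μ := P) hh.aemeasurable
  have h3 : IndepFun g h P := h2.comp (φ := Prod.snd) (ψ := id) measurable_snd measurable_id
  rw [indepFun_iff_map_prod_eq_prod_map_map (by fun_prop) (by fun_prop)] at h1 h2 h3 ⊢
  rw [h3]
  rw [h1] at h2
  rw [← (measurePreserving_prodAssoc (P.map f) (P.map g) (P.map h)).map_eq, ← h2,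
    Measure.map_map (by fun_prop) (by fun_prop)]
  rfl

lemma indepFun_comp_measurePreserving {Ω α β : Type*} {mΩ : MeasurableSpace Ω} [MeasurableSpace α]
    [MeasurableSpace β] {P : Measure Ω} [IsProbabilityMeasure P] {T : Ω → Ω}
    (hT : MeasurePreserving T P P) {f : Ω → α} {g : Ω → β} (hf : Measurable f) (hg : Measurable g)
    (h : IndepFun f g P) : IndepFun (fun ω => f (T ω)) (fun ω => g (T ω)) P := by
  have hTm := hT.measurable
  rw [indepFun_iff_map_prod_eq_prod_map_map (by fun_prop) (by fun_prop)] at h ⊢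
  conv at h =>
    rw [← hT.map_eq, Measure.map_map (by fun_prop) (by fun_prop),
      Measure.map_map (by fun_prop) (by fun_prop), Measure.map_map (by fun_prop) (by fun_prop)]
  exact h

/-- The σ-algebra generated by the sites `1, 2, …`. -/
@[reducible]
def future : MeasurableSpace (ℤ → ℝ × ℝ) :=
  ⨆ j ∈ Set.Ici (1 : ℤ), MeasurableSpace.comap (fun x => x j) inferInstance

lemma measurable_eval_future {j : ℤ} (h : 1 ≤ j) : Measurable[future] fun x => x j :=
  Measurable.mono (comap_measurable _)
    (le_iSup₂_of_le (f := fun j (_ : j ∈ Set.Ici (1 : ℤ)) =>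
      MeasurableSpace.comap (fun x : ℤ → ℝ × ℝ => x j) inferInstance) j h le_rfl) le_rfl

/-- The series at site -1 of the reflected configuration involves only I_j and J_j with j ≥ 1. The
site 0 is therefore left free. -/
lemma measurable_umin_reflect_future :
    Measurable[future] fun x => umin (reflect x) (-1) := by
  have hr : ∀ (k : ℕ) (n : ℤ), n ≤ -1 → Measurable[future] fun x => ratioProd (reflect x) n k := by
    intro k
    induction k with
    | zero => exact fun n _ => measurable_const
    | succ k ih =>
      intro n hn
      have h1 := (measurable_eval_future (j := -(n - 1) - 1) (by omega)).snd
      have h2 := (measurable_eval_future (j := -n) (by omega)).fst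
      exact (h1.div h2).mul (ih (n - 1) (by omega))
  have ht : ∀ k : ℕ, Measurable[future] fun x => term (reflect x) (-1) k := fun k =>
    (hr k (-1) le_rfl).div (measurable_eval_future (j := -(-1 - k)) (by omega)).fst
  let _ : MeasurableSpace (ℤ → ℝ × ℝ) := future
  exact (Measurable.tsum fun k => (ht k).ennreal_ofReal).ennreal_toReal.inv

variable {μ ν : Measure ℝ} [IsProbabilityMeasure μ] [IsProbabilityMeasure ν]

lemma indepFun_eval_umin_reflect :
    IndepFun (fun x : ℤ → ℝ × ℝ => x 0) (fun x => umin (reflect x) (-1)) (siteLaw μ ν) := by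
  have h := indep_iSup_of_disjoint (S := {0}) (T := Set.Ici 1)
    (m := fun j : ℤ => MeasurableSpace.comap (fun x : ℤ → ℝ × ℝ => x j) inferInstance)
    (fun j => Measurable.comap_le (by fun_prop)) (iIndepFun_eval (μ := μ) (ν := ν)).iIndep
    (by simp)
  rw [IndepFun_iff_Indep]
  refine indep_of_indep_of_le_right (m₂ := future) (by simpa [future] using h) ?_
  exact measurable_umin_reflect_future.comap_le

lemma indepFun_fst_snd : IndepFun (fun x : ℤ → ℝ × ℝ => (x 0).1) (fun x => (x 0).2)
    (siteLaw μ ν) := by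
  rw [indepFun_iff_map_prod_eq_prod_map_map (Measurable.aemeasurable (by fun_prop))
    (Measurable.aemeasurable (by fun_prop)), siteLaw_map_fst, siteLaw_map_snd]
  exact siteLaw_map_eval 0

theorem gamma_of_invariant (hpos : ∀ᵐ x ∂siteLaw μ ν, Pos x)
    (hfin : ∀ᵐ x ∂siteLaw μ ν, ∀ n, vmin x n ≠ ∞)
    (hT : MeasurePreserving evolve (siteLaw μ ν) (siteLaw μ ν))
    (hrev : ∀ᵐ x ∂siteLaw μ ν, umin (reflect (evolve x)) (-1) = umin x 1)
    (hnt : ¬ ∃ a b : ℝ, μ = Measure.dirac a ∧ ν = Measure.dirac b) :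
    ∃ l₁ l₂ c : ℝ, 0 < l₁ ∧ 0 < l₂ ∧ 0 < c ∧
      μ = gammaMeasure (l₁ + l₂) c ∧ ν = gammaMeasure l₁ c := by
  have hupos : ∀ᵐ x ∂siteLaw μ ν, ∀ n, 0 < umin x n := by
    filter_upwards [hpos, hfin] with x h1 h2 n using inv_pos.2 (vmin_toReal_pos h1 (h2 n))
  have hJU : IndepFun (fun x : ℤ → ℝ × ℝ => (x 0).2) (fun x => umin x 0) (siteLaw μ ν) := by
    rw [IndepFun_iff_Indep]
    refine indep_of_indep_of_le_right (indep_of_indep_of_le_left (indep_drive_past 0) ?_)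
      (measurable_umin_past 0).comap_le
    exact (measurable_snd.comp (comap_measurable fun x : ℤ → ℝ × ℝ => drive x 0)).comap_le
  -- Independence of I_0 from (J_0, reversed carrier) is transported along `evolve`. By `hrev` the
  -- reversed carrier at time 1 is U_1, and J'_0/(J'_0+U_1) equals J_0/(J_0+U_0), the common factor
  -- I_1/I'_0 cancelling.
  have hSR : IndepFun (fun x : ℤ → ℝ × ℝ => (x 0).2 + umin x 0)
      (fun x => (x 0).2 / ((x 0).2 + umin x 0)) (siteLaw μ ν) := by
    have h1 := indepFun_comp_measurePreserving hT (by fun_prop) (by fun_prop)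
      (indepFun_prodMk_assoc (by fun_prop) (by fun_prop) (by fun_prop)
        (indepFun_fst_snd (μ := μ) (ν := ν)) indepFun_eval_umin_reflect)
    have h2 := h1.comp (φ := id) (ψ := fun p : ℝ × ℝ => p.1 / (p.1 + p.2)) measurable_id
      (by fun_prop)
    refine h2.congr (ae_of_all _ fun x => rfl) ?_
    filter_upwards [hpos, hfin, hrev, hupos] with x h3 h4 h5 h6
    have e := umin_succ h3 h4 0
    rw [zero_add] at e
    simp only [Function.comp_apply]
    rw [h5, e]
    have p1 := (h3 1).1
    have p2 := (h3 0).2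
    have p3 := h6 0
    simp only [evolve, zero_add]
    field_simp
  -- By invariance I_0 has the law of I'_0 = J_0 + U_0.
  have hsum : μ = (((siteLaw μ ν).map fun x => (x 0).2).prod
      ((siteLaw μ ν).map fun x => umin x 0)).map fun p => p.1 + p.2 := by
    rw [← (indepFun_iff_map_prod_eq_prod_map_map (Measurable.aemeasurable (by fun_prop))
      (Measurable.aemeasurable (by fun_prop))).1 hJU,
      Measure.map_map (by fun_prop) (by fun_prop)]
    conv_lhs => rw [← siteLaw_map_fst (μ := μ) (ν := ν) 0, ← hT.map_eq,
      Measure.map_map (by fun_prop) (by fun_prop)]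
    rfl
  rcases lukacs (by fun_prop) (by fun_prop) (hpos.mono fun x h => (h 0).2)
    (hupos.mono fun x h => h 0) hJU hSR with ⟨a, b, h1, h2⟩ | ⟨l₁, l₂, c, hl₁, hl₂, hc, h1, h2⟩
  · refine absurd ⟨a + b, a, ?_, ?_⟩ hnt
    · rw [hsum, h1, h2, Measure.dirac_prod_dirac]
      exact Measure.map_dirac' (measurable_fst.add measurable_snd) (a, b)
    · rw [← h1, siteLaw_map_snd]
  · have := isProbabilityMeasure_gammaMeasure (add_pos hl₁ hl₂) hc
    refine ⟨l₁, l₂, c, hl₁, hl₂, hc, ?_, ?_⟩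
    · obtain ⟨β, hβ, key⟩ := exists_map_sum_ratio hl₁ hl₂ hc
      have h3 := congrArg (Measure.map Prod.fst) key
      rw [Measure.map_map (by fun_prop) (by fun_prop), Measure.map_fst_prod, measure_univ,
        one_smul] at h3
      rw [hsum, h1, h2]
      exact h3
    · rw [← h1, siteLaw_map_snd]

end Converse

end Toda

/-! ### Transfer to the random configuration -/

theorem mainTheorem11 {Ω : Type*} [MeasurableSpace Ω] (P : Measure Ω) [IsProbabilityMeasure P]
    (I J : ℤ → Ω → ℝ) (hI : ∀ n, Measurable (I n)) (hJ : ∀ n, Measurable (J n))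
    -- the pairs `(I_n, J_n)` are independent and identically distributed in `n`
    (hindep : iIndepFun (fun n ω => (I n ω, J n ω)) P)
    (hident : ∀ n, IdentDistrib (fun ω => (I n ω, J n ω)) (fun ω => (I 0 ω, J 0 ω)) P P)
    -- `I_n` is independent of `J_n`
    (hIJ : ∀ n, IndepFun (I n) (J n) P) :
    -- gamma laws are invariant
    (∀ l₁ l₂ c : ℝ, 0 < l₁ → 0 < l₂ → 0 < c →
      P.map (I 0) = gammaMeasure (l₁ + l₂) c → P.map (J 0) = gammaMeasure l₁ c →
        IsTodaInvariant P (fun ω n => (I n ω, J n ω))) ∧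
    -- every invariant law is of this form, unless both marginals are point masses
    (IsTodaInvariant P (fun ω n => (I n ω, J n ω)) →
      (¬ ∃ a b : ℝ, P.map (I 0) = Measure.dirac a ∧ P.map (J 0) = Measure.dirac b) →
        ∃ l₁ l₂ c : ℝ, 0 < l₁ ∧ 0 < l₂ ∧ 0 < c ∧
          P.map (I 0) = gammaMeasure (l₁ + l₂) c ∧ P.map (J 0) = gammaMeasure l₁ c) := by
  set X : Ω → ℤ → ℝ × ℝ := fun ω n => (I n ω, J n ω) with hXdef
  have hX : Measurable X := by fun_prop
  set μ := P.map (I 0) with hμ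
  set ν := P.map (J 0) with hν
  have : IsProbabilityMeasure μ := Measure.isProbabilityMeasure_map (hI 0).aemeasurable
  have : IsProbabilityMeasure ν := Measure.isProbabilityMeasure_map (hJ 0).aemeasurable
  have hlaw : P.map X = Toda.siteLaw μ ν := by
    refine (hindep.map_fun_eq_infinitePi_map fun n => by fun_prop).trans ?_
    simp only [(hident _).map_eq]
    rw [(indepFun_iff_map_prod_eq_prod_map_map (hI 0).aemeasurable (hJ 0).aemeasurable).1 (hIJ 0)]
    rfl
  have hpull : ∀ {p : (ℤ → ℝ × ℝ) → Prop}, (∀ᵐ x ∂Toda.siteLaw μ ν, p x) → ∀ᵐ ω ∂P, p (X ω) := by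
    intro p hp
    rw [← hlaw] at hp
    exact ae_of_ae_map hX.aemeasurable hp
  -- Going from `P` to the law requires a measurable event. Hence existence of a solution is used
  -- only through measurable consequences in terms of `Pos`, `vmin` and `umin`.
  have hpush : ∀ {p : (ℤ → ℝ × ℝ) → Prop}, MeasurableSet {x | p x} → (∀ᵐ ω ∂P, p (X ω)) →
      ∀ᵐ x ∂Toda.siteLaw μ ν, p x := by
    intro p hm hp
    rw [← hlaw]
    exact (ae_map_iff hX.aemeasurable hm).2 hp
  constructor
  · intro l₁ l₂ c hl₁ hl₂ hc h1 h2
    have := isProbabilityMeasure_gammaMeasure hl₂ hc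
    have hinv : ((μ.prod ν).prod (gammaMeasure l₂ c)).map Toda.localMap =
        (μ.prod ν).prod (gammaMeasure l₂ c) := by
      rw [h1, h2]; exact Toda.localMap_gamma hl₁ hl₂ hc
    have pμ : ∀ᵐ a ∂μ, 0 < a := by rw [h1]; exact Toda.gammaMeasure_ae_pos _ _
    have pν : ∀ᵐ a ∂ν, 0 < a := by rw [h2]; exact Toda.gammaMeasure_ae_pos _ _
    have pγ := Toda.gammaMeasure_ae_pos l₂ c
    have hev := hpull (Toda.ae_evolution hinv pμ pν pγ)
    have heq : (fun ω => todaStep (X ω)) =ᵐ[P] fun ω => Toda.evolve (X ω) :=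
      hev.mono fun ω h => h.2
    have hm : Measurable fun ω => Toda.evolve (X ω) := Toda.measurable_evolve.comp hX
    refine ⟨hev.mono fun ω h => h.1, ⟨hm.aemeasurable.congr heq.symm, hX.aemeasurable, ?_⟩⟩
    rw [Measure.map_congr heq, hlaw,
      ← Toda.siteLaw_map_evolve hinv (Toda.ae_pos pμ pν) pγ, ← hlaw,
      Measure.map_map Toda.measurable_evolve hX]
    rfl
  · intro hinv hnt
    have hsol : ∀ᵐ ω ∂P, ∃ w : TodaField, w.SolvesIVP (X ω) :=
      hinv.mem_domain.mono fun ω h => h.exists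
    have hpos : ∀ᵐ x ∂Toda.siteLaw μ ν, Toda.Pos x := by
      refine ae_all_iff.2 fun n => hpush ?_ (hsol.mono fun ω h => ?_)
      · have h1 : Measurable fun x : ℤ → ℝ × ℝ => (x n).1 := by fun_prop
        have h2 : Measurable fun x : ℤ → ℝ × ℝ => (x n).2 := by fun_prop
        exact (measurableSet_lt measurable_const h1).inter (measurableSet_lt measurable_const h2)
      · obtain ⟨w, hw, h0⟩ := h
        rw [← h0]
        exact Toda.config_pos hw 0 n
    have hfin : ∀ᵐ x ∂Toda.siteLaw μ ν, ∀ n, Toda.vmin x n ≠ ⊤ := by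
      refine ae_all_iff.2 fun n => hpush ?_ (hsol.mono fun ω h => ?_)
      · exact (measurableSet_eq_fun (by fun_prop) measurable_const).compl
      · obtain ⟨w, hw, h0⟩ := h
        rw [← h0]
        exact Toda.vmin_ne_top hw 0 n
    have hsmall := Toda.ae_ratioProd_small hpos 0 (hfin.mono fun x h => h 0)
    have hT : MeasurePreserving Toda.evolve (Toda.siteLaw μ ν) (Toda.siteLaw μ ν) := by
      refine ⟨Toda.measurable_evolve, ?_⟩
      have h := hinv.identDistrib.map_eq
      have heq : (fun ω => todaStep (X ω)) =ᵐ[P] fun ω => Toda.evolve (X ω) := by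
        filter_upwards [hinv.mem_domain, hpull hsmall] with ω h1 h2
        exact Toda.todaStep_eq_evolve h1 h2
      rw [Measure.map_congr heq] at h
      rw [← hlaw, Measure.map_map Toda.measurable_evolve hX]
      exact h
    have hR : MeasurePreserving Toda.reflect (Toda.siteLaw μ ν) (Toda.siteLaw μ ν) :=
      ⟨Toda.measurable_reflect, Toda.siteLaw_map_reflect⟩
    have hsmall' := hT.quasiMeasurePreserving.ae (hR.quasiMeasurePreserving.ae hsmall)
    refine Toda.gamma_of_invariant hpos hfin hT (hpush ?_ ?_) hnt
    · exact measurableSet_eq_fun ((Toda.measurable_umin _).comp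
        (Toda.measurable_reflect.comp Toda.measurable_evolve)) (Toda.measurable_umin 1)
    · filter_upwards [hsol, hpull hsmall, hpull hsmall'] with ω h1 h2 h3
      obtain ⟨w, hw, h0⟩ := h1
      rw [← h0] at h2 h3 ⊢
      have hc := Toda.config_succ hw 0 h2
      rw [← hc] at h3 ⊢
      rw [← Toda.U_eq_umin hw 0 h2 1]
      -- The solution seen from time 1 and then reversed starts from the reflection of the
      -- configuration at time 1, and its carrier at time 0, site -1 is the original U at time 0,
      -- site 1.
      exact (Toda.U_eq_umin (Toda.isSolution_reverse (Toda.isSolution_shift hw 1)) 0 h3 (-1)).symm
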